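/- All graphs are finite and simple. A graph $G$ with vertex set $V$, $|V|=n$, is \emph{strongly chordal} if its vertices have a strong elimination ordering $v_1,\dots,v_n$: whenever $i<j$, $k<l$, $v_k,v_l\in N[v_i]$ and $v_k\in N[v_j]$, then $v_l\in N[v_j]$. A \emph{strong chord} of an even cycle $C$ of length at least $6$ in $G$ (not necessarily induced) is an edge of $G$ that joins two vertices of $C$, is not an edge of $C$, and whose ends are at odd distance along $C$. A \emph{clique tree} of $G$ is a tree whose nodes are the maximal cliques of $G$ and in which, for every vertex $w$, the nodes containing $w$ induce a subtree. A $P_4$ path from $u$ to $v$ is a path $u,x,y,v$ on four distinct vertices; further edges among these vertices are allowed. \textbf{(a) Characterization.} Let $G$ be strongly chordal and $\{u,v\}$ an edge of $G$. Then $G-\{u,v\}$ is strongly chordal if and only if (i) $\{u,v\}$ is contained in exactly one maximal clique of $G$, and (ii) there is no $6$-cycle of $G$ of which $\{u,v\}$ is the only strong chord. Condition (i) holds if and only if $\{u,v\}$ is contained in exactly one node of $T$, for any clique tree $T$ of $G$. There is a $6$-cycle of $G$ of which $\{u,v\}$ is the only strong chord if and only if, in the induced subgraph $G[N[u]\cup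 N[v]]$, there are two internally disjoint $P_4$ paths $u,x,y,v$ and $u,x',y',v$ such that $\{u,v\}$ is the only strong chord of the $6$-cycle $u,x,y,v,y',x'$. \textbf{(b) Algorithm.} Consider a unit-cost random access machine whose memory holds the adjacency matrix of a strongly chordal graph $G$ on $n$ vertices with $m$ edges, the vertex lists of the nodes of a clique tree $T$ of $G$, and two vertices $u,v$. \emph{Delete-Query} answers False if $\{u,v\}$ is not an edge or does not lie in exactly one node of $T$. Otherwise it lists all $P_4$ paths from $u$ to $v$ in $G[N[u]\cup N[v]]$ by a search from $u$, and answers False if for some internally disjoint pair of them $\{u,v\}$ is the only strong chord of the resulting $6$-cycle, and True otherwise. Its answer is True if and only if $\{u,v\}$ is an edge of $G$ and $G-\{u,v\}$ is strongly chordal. If $\{u,v\}$ is an edge, it takes $O(d_u^2d_v^2(n+m))$ steps, where $d_u,d_v$ are the degrees of $u,v$ in $G$; if not, it takes $O(1)$ steps. \emph{Delete} (on the adjacency matrix) runs Delete-Query and, if the answer is True, removes $\{u,v\}$ in $O(1)$ further steps. The stored graph is afterwards strongly chordal; it is $G-\{u,v\}$ if the answer was True, and $G$ otherwise. -/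

import Mathlib

/-! ### Strongly chordal graphs, strong chords, clique trees -/

namespace SCDel

/-- The closed neighbourhood `N[w]`. -/
def closedNbhd {V : Type*} (G : SimpleGraph V) (w : V) : Set V :=
  insert w (G.neighborSet w)

/-- `σ` lists the vertices as `v_0, …, v_{n-1}`. The ordering is a strong elimination ordering if
for all `i < j` and `k < l`, `v_k, v_l ∈ N[v_i]` and `v_k ∈ N[v_j]` imply `v_l ∈ N[v_j]`; that is,
the neighbourhood matrix has no submatrix with rows `1 1` and `1 0`. -/
def IsStrongElimOrdering {V : Type*} (G : SimpleGraph V) {n : ℕ} (σ : Fin n ≃ V) : Prop :=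
  ∀ i j k l : Fin n, i < j → k < l →
    σ k ∈ closedNbhd G (σ i) → σ l ∈ closedNbhd G (σ i) →
    σ k ∈ closedNbhd G (σ j) → σ l ∈ closedNbhd G (σ j)

/-- A finite graph is strongly chordal if it has a strong elimination ordering. -/
def StronglyChordal {V : Type*} [Fintype V] (G : SimpleGraph V) : Prop :=
  ∃ σ : Fin (Fintype.card V) ≃ V, IsStrongElimOrdering G σ

/-- The graph `G - {u, v}`: the same vertices, the edge `{u, v}` removed. -/
abbrev deleteEdge {V : Type*} (G : SimpleGraph V) (u v : V) : SimpleGraph V :=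
  G.deleteEdges {s(u, v)}

/-- `c 0, c 1, …, c (L-1)` is a cycle of length `L` of `G` (not necessarily an induced one);
indices are read modulo `L`. -/
def IsCycleIn {V : Type*} (G : SimpleGraph V) {L : ℕ} [NeZero L] (c : Fin L → V) : Prop :=
  3 ≤ L ∧ Function.Injective c ∧ ∀ i : Fin L, G.Adj (c i) (c (i + 1))

/-- Distance along a cycle of length `L` between its positions `i` and `j`: the shorter arc. -/
def arcDist {L : ℕ} (i j : Fin L) : ℕ :=
  min (i - j).val (j - i).val

/-- `{x, y}` is a strong chord of the even cycle `c` of length at least six: an edge of `G` that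
joins two vertices of the cycle, is not an edge of the cycle, and whose ends are at odd distance
along the cycle. -/
def IsStrongChord {V : Type*} (G : SimpleGraph V) {L : ℕ} [NeZero L] (c : Fin L → V)
    (x y : V) : Prop :=
  Even L ∧ 6 ≤ L ∧ IsCycleIn G c ∧
    ∃ i j : Fin L, c i = x ∧ c j = y ∧ G.Adj x y ∧ arcDist i j ≠ 1 ∧ Odd (arcDist i j)

/-- `{u, v}` is a strong chord of `c`, and `c` has no other one. -/
def IsOnlyStrongChord {V : Type*} (G : SimpleGraph V) {L : ℕ} [NeZero L] (c : Fin L → V)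
    (u v : V) : Prop :=
  IsStrongChord G c u v ∧ ∀ x y : V, IsStrongChord G c x y → s(x, y) = s(u, v)

/-- `K` is an inclusion-maximal clique of `G`. -/
def IsMaxClique {V : Type*} (G : SimpleGraph V) (K : Finset V) : Prop :=
  Maximal (fun S : Finset V => G.IsClique (S : Set V)) K

/-- `T` is a clique tree of `G`, its node `i` standing for the clique `K i`: the nodes are, without
repetition, the maximal cliques of `G`, and the nodes that contain any given vertex form a
subtree. (Disconnected graphs are allowed: cliques of different components may be joined in `T`.) -/
structure IsCliqueTree {V ι : Type*} (G : SimpleGraph V) (K : ι → Finset V)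
    (T : SimpleGraph ι) : Prop where
  isTree : T.IsTree
  injective : Function.Injective K
  range_eq : ∀ S : Finset V, (∃ i, K i = S) ↔ IsMaxClique G S
  subtree : ∀ w : V, (T.induce {i | w ∈ K i}).Connected

/-- `AuxNodes = N[u] ∪ N[v]`. -/
def auxNodes {V : Type*} (G : SimpleGraph V) (u v : V) : Set V :=
  closedNbhd G u ∪ closedNbhd G v

/-- `u - x - y - v` is a path on four (distinct) vertices. Edges between non-consecutive vertices
are allowed. -/
def IsP4 {W : Type*} (H : SimpleGraph W) (u x y v : W) : Prop :=
  H.Adj u x ∧ H.Adj x y ∧ H.Adj y v ∧ u ≠ y ∧ u ≠ v ∧ x ≠ v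

/-- In `G[AuxNodes]` there are two internally disjoint `P4` paths `u - x - y - v` and
`u - x' - y' - v` such that `{u, v}` is the only strong chord of the six-cycle
`u, x, y, v, y', x'` which they form. -/
def HasBadP4Pair {V : Type*} (G : SimpleGraph V) (u v : V) : Prop :=
  ∃ a b x y x' y' : auxNodes G u v, (a : V) = u ∧ (b : V) = v ∧
    IsP4 (G.induce (auxNodes G u v)) a x y b ∧ IsP4 (G.induce (auxNodes G u v)) a x' y' b ∧
    x ≠ x' ∧ x ≠ y' ∧ y ≠ x' ∧ y ≠ y' ∧
    IsOnlyStrongChord (L := 6) (G.induce (auxNodes G u v)) ![a, x, y, b, y', x'] a b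

/-! ### A unit-cost random access machine with structured programs

Every register and every array cell holds a natural number. Evaluating an expression or a test
costs one step per node of its syntax tree, each assignment one step, each branching one step, and
each loop one step plus one step per iteration, in addition to what is executed inside. The only
arithmetic operation is addition of a constant. -/

/-- Register names. -/
inductive Reg
  | n | u | v | nodes | answer | count | hits | numAux | numPaths
  | i | j | x | y | x' | y'
  deriving DecidableEq

/-- Names of (two-dimensional) arrays; a one-dimensional array uses row `0` only. -/
inductive Arr
  | adj | size | node | aux | pathX | pathY
  deriving DecidableEq

/-- Memory contents. -/
structure State where
  reg : Reg → ℕ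
  cell : Arr → ℕ → ℕ → ℕ

/-- The state after writing `k` to register `r`. -/
def State.setReg (s : State) (r : Reg) (k : ℕ) : State :=
  { s with reg := fun r' => if r' = r then k else s.reg r' }

/-- The state after writing `k` to the array cell `a[p][q]`. -/
def State.setCell (s : State) (a : Arr) (p q k : ℕ) : State :=
  { s with cell := fun a' p' q' => if a' = a ∧ p' = p ∧ q' = q then k else s.cell a' p' q' }

/-- Arithmetic expressions: constants, registers, array cells, and addition of a constant. -/
inductive Expr
  | lit (k : ℕ)
  | reg (r : Reg)
  | cell (a : Arr) (p q : Expr)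
  | addLit (e : Expr) (k : ℕ)

/-- Value of an expression. -/
def Expr.eval (s : State) : Expr → ℕ
  | .lit k => k
  | .reg r => s.reg r
  | .cell a p q => s.cell a (p.eval s) (q.eval s)
  | .addLit e k => e.eval s + k

/-- Number of steps needed to evaluate an expression. -/
def Expr.cost : Expr → ℕ
  | .lit _ => 1
  | .reg _ => 1
  | .cell _ p q => p.cost + q.cost + 1
  | .addLit e _ => e.cost + 1

/-- Tests. -/
inductive Test
  | eq (e₁ e₂ : Expr)
  | not (t : Test)
  | and (t₁ t₂ : Test)
  | or (t₁ t₂ : Test)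

/-- Value of a test. -/
def Test.eval (s : State) : Test → Bool
  | .eq e₁ e₂ => decide (e₁.eval s = e₂.eval s)
  | .not t => !(t.eval s)
  | .and t₁ t₂ => t₁.eval s && t₂.eval s
  | .or t₁ t₂ => t₁.eval s || t₂.eval s

/-- Number of steps needed to evaluate a test (no short-circuiting). -/
def Test.cost : Test → ℕ
  | .eq e₁ e₂ => e₁.cost + e₂.cost + 1
  | .not t => t.cost + 1
  | .and t₁ t₂ => t₁.cost + t₂.cost + 1
  | .or t₁ t₂ => t₁.cost + t₂.cost + 1

/-- Programs. `loop r e c` evaluates `e` once, to `k`, and then executes `c` for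
`r = 0, 1, …, k - 1` in this order. -/
inductive Prog
  | skip
  | set (r : Reg) (e : Expr)
  | store (a : Arr) (p q e : Expr)
  | seq (c₁ c₂ : Prog)
  | ite (t : Test) (c₁ c₂ : Prog)
  | loop (r : Reg) (e : Expr) (c : Prog)

/-- Execute `step 0, step 1, …, step (k - 1)` in this order; one step per iteration is added to the
steps taken inside. -/
def iterate (step : ℕ → State → State × ℕ) : ℕ → State → State × ℕ
  | 0, s => (s, 0)
  | k + 1, s =>
    let before := iterate step k s
    let last := step k before.1
    (last.1, before.2 + last.2 + 1)

/-- Execute a program: the final state and the number of steps. -/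
def Prog.run : Prog → State → State × ℕ
  | .skip, s => (s, 0)
  | .set r e, s => (s.setReg r (e.eval s), e.cost + 1)
  | .store a p q e, s =>
    (s.setCell a (p.eval s) (q.eval s) (e.eval s), p.cost + q.cost + e.cost + 1)
  | .seq c₁ c₂, s =>
    let first := c₁.run s
    let second := c₂.run first.1
    (second.1, first.2 + second.2)
  | .ite t c₁ c₂, s =>
    let branch := if t.eval s then c₁.run s else c₂.run s
    (branch.1, branch.2 + t.cost + 1)
  | .loop r e c, s =>
    let body := iterate (fun k s' => c.run (s'.setReg r k)) (e.eval s) s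
    (body.1, body.2 + e.cost + 1)

/-- The final state of a run. -/
def Prog.out (c : Prog) (s : State) : State := (c.run s).1

/-- The number of steps of a run. -/
def Prog.time (c : Prog) (s : State) : ℕ := (c.run s).2

/-- Execute a list of programs one after the other. -/
def block : List Prog → Prog
  | [] => .skip
  | c :: cs => .seq c (block cs)

/-- The branching without an `else` part. -/
def when (t : Test) (c : Prog) : Prog := .ite t c .skip

/-- `r := r + 1` -/
def incr (r : Reg) : Prog := .set r (.addLit (.reg r) 1)

/-- The test that the vertices stored in registers `a` and `b` are adjacent: `adj[a][b] = 1`. -/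
def adjTest (a b : Reg) : Test := .eq (.cell .adj (.reg a) (.reg b)) (.lit 1)

/-- The test that registers `a` and `b` hold the same value. -/
def sameTest (a b : Reg) : Test := .eq (.reg a) (.reg b)

/-! ### The algorithms -/

/-- `count :=` the number of clique tree nodes that contain both `u` and `v`, by intersecting every
node with `{u, v}`. -/
def countNodes : Prog := block [
  .set .count (.lit 0),
  .loop .i (.reg .nodes) (block [
    .set .hits (.lit 0),
    .loop .j (.cell .size (.lit 0) (.reg .i))
      (when (.or (.eq (.cell .node (.reg .i) (.reg .j)) (.reg .u))
                 (.eq (.cell .node (.reg .i) (.reg .j)) (.reg .v)))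
        (incr .hits)),
    when (.eq (.reg .hits) (.lit 2)) (incr .count)])]

/-- List `N[u] ∪ N[v]` in `aux[0][0], …, aux[0][numAux - 1]`. -/
def collectAux : Prog := block [
  .set .numAux (.lit 0),
  .loop .x (.reg .n)
    (when (.or (.or (sameTest .x .u) (sameTest .x .v)) (.or (adjTest .u .x) (adjTest .v .x)))
      (block [
        .store .aux (.lit 0) (.reg .numAux) (.reg .x),
        incr .numAux]))]

/-- List all `P4` paths `u - x - y - v` inside `N[u] ∪ N[v]`: search from `u`, first its neighbours
`x`, then their neighbours `y`, keeping those that are adjacent to `v`. The `p`-th path found has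
`x = pathX[0][p]` and `y = pathY[0][p]`. -/
def collectPaths : Prog := block [
  .set .numPaths (.lit 0),
  .loop .i (.reg .numAux) (block [
    .set .x (.cell .aux (.lit 0) (.reg .i)),
    when (.and (adjTest .u .x) (.not (sameTest .x .v)))
      (.loop .j (.reg .numAux) (block [
        .set .y (.cell .aux (.lit 0) (.reg .j)),
        when (.and (.and (adjTest .x .y) (adjTest .y .v)) (.not (sameTest .y .u)))
          (block [
            .store .pathX (.lit 0) (.reg .numPaths) (.reg .x),
            .store .pathY (.lit 0) (.reg .numPaths) (.reg .y),
            incr .numPaths])]))])]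

/-- `answer := 1`, changed to `0` if some pair of internally disjoint paths `u - x - y - v` and
`u - x' - y' - v` in the list has neither of the strong chords `{x, y'}` and `{y, x'}` of the
six-cycle `u, x, y, v, y', x'`. -/
def checkPairs : Prog := block [
  .set .answer (.lit 1),
  .loop .i (.reg .numPaths) (.loop .j (.reg .numPaths) (block [
    .set .x (.cell .pathX (.lit 0) (.reg .i)),
    .set .y (.cell .pathY (.lit 0) (.reg .i)),
    .set .x' (.cell .pathX (.lit 0) (.reg .j)),
    .set .y' (.cell .pathY (.lit 0) (.reg .j)),
    when (.and
        (.and (.and (.not (sameTest .x .x')) (.not (sameTest .x .y')))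
              (.and (.not (sameTest .y .x')) (.not (sameTest .y .y'))))
        (.and (.not (adjTest .x .y')) (.not (adjTest .y .x'))))
      (.set .answer (.lit 0))]))]

/-- Delete-Query: the register `answer` receives `1` for True and `0` for False. -/
def deleteQuery : Prog := block [
  .set .answer (.lit 0),
  when (adjTest .u .v) (block [
    countNodes,
    when (.eq (.reg .count) (.lit 1)) (block [
      collectAux,
      collectPaths,
      checkPairs])])]

/-- Delete, on the adjacency matrix: query, and remove the edge if the answer is True. -/
def delete : Prog := block [
  deleteQuery,
  when (.eq (.reg .answer) (.lit 1)) (block [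
    .store .adj (.reg .u) (.reg .v) (.lit 0),
    .store .adj (.reg .v) (.reg .u) (.lit 0)])]

/-- The array `adj` holds the adjacency matrix of `G`. -/
def StoresGraph {n : ℕ} (s : State) (G : SimpleGraph (Fin n)) : Prop :=
  ∀ p q : Fin n, (G.Adj p q → s.cell .adj p q = 1) ∧ (¬ G.Adj p q → s.cell .adj p q = 0)

/-- The memory holds the input of the algorithms: the number of vertices, the vertices `u` and `v`,
the adjacency matrix of `G`, and the nodes of a clique tree, node `p` being stored as the list
`node[p][0], …, node[p][size[0][p] - 1]` of the vertices of `K p`, in any order and without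
repetition. The rest of the memory is arbitrary. -/
structure StoresInput {n k : ℕ} (s : State) (G : SimpleGraph (Fin n))
    (K : Fin k → Finset (Fin n)) (u v : Fin n) : Prop where
  numVertices : s.reg .n = n
  left : s.reg .u = u
  right : s.reg .v = v
  graph : StoresGraph s G
  numNodes : s.reg .nodes = k
  size : ∀ p : Fin k, s.cell .size 0 p = (K p).card
  node_mem : ∀ p : Fin k, ∀ q < (K p).card, ∃ w ∈ K p, s.cell .node p q = (w : ℕ)
  node_surj : ∀ p : Fin k, ∀ w ∈ K p, ∃ q < (K p).card, s.cell .node p q = (w : ℕ)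

end SCDel

/-!
A 0-1 matrix is totally balanced if the bipartite graph of its rows and columns has no induced
cycle of length at least six. A graph is strongly chordal if and only if its closed neighbourhood
matrix is totally balanced (`stronglyChordal_iff_forall_not_inducedCycle`). In one direction, a
strong elimination ordering is a Γ-free ordering of this matrix, and the smallest row of an induced
cycle would produce a `Γ` (`GammaFree.not_inducedCycle`). In the other direction, a symmetric matrix
with unit diagonal has a symmetric doubly lexical ordering: one that maximizes a quadratic form with
weights `2 ^ i` (`exists_lexOrdered`). From a `Γ` in such an ordering one grows a ladder, choosing
at each step the last place in which two consecutive rows or columns differ. The ladder has strictly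
increasing rows, so that it must close, and then it is an induced cycle (`LexOrdered.gammaFree`).

Let now `{u, v}` be an edge of the strongly chordal graph `G`. Suppose that the common neighbours of
`u` and `v` are pairwise adjacent and that no six-cycle has `{u, v}` as its only strong chord. An
induced cycle of the neighbourhood matrix of `G - {u, v}` becomes in that of `G` a cycle with at most
the two chords (row `u`, column `v`) and (row `v`, column `u`). Every piece into which the chords cut
it is an induced cycle of the matrix of `G`, hence of length four. So the cycle has length six or
eight, and each of these cases yields two nonadjacent common neighbours of `u` and `v`, an induced
four-cycle of `G`, or an excluded six-cycle (`not_inducedCycle_of_row_col`). The converse is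
immediate, since strongly chordal graphs have neither induced four-cycles nor six-cycles without
strong chords (`stronglyChordal_deleteEdge_iff`). The common neighbours are pairwise adjacent if and
only if the edge lies in exactly one maximal clique.

The programs are analysed with a loop rule which combines an invariant with a bound on the number of
steps (`Prog.loop_spec`). The lists which they build are described as bijections from an initial
segment of `ℕ` onto the set listed, which gives both correctness and the length of the list:
`N[u] ∪ N[v]` has at most `d_u + d_v ≤ 2 d_u d_v` elements and there are at most `d_u d_v` paths.
Scanning the clique tree takes time linear in the total size of the maximal cliques, which is at most
`n + 2 m` because maximal cliques have distinct first vertices in the elimination ordering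
(`StronglyChordal.sum_card_maxClique_le`).
-/

/-! ### Cycles of a relation and Γ-free orderings -/

namespace SCDel

/-- The ordering `f` of the rows and columns of the 0-1 matrix `R` is Γ-free: no two rows and two
columns form the submatrix with rows `1 1` and `1 0`. -/
def GammaFree {V : Type*} (R : V → V → Prop) (f : V → ℕ) : Prop :=
  ∀ a b x y, f a < f b → f x < f y → R a x → R a y → R b x → R b y

/-- The rows `r 0, …, r (k-1)` and the columns `c 0, …, c (k-1)` induce, in the bipartite graph of
the relation `R` between rows and columns, the cycle `r 0, c 0, r 1, c 1, …, r (k-1), c (k-1)` of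
length `2 * k ≥ 6`. Values of `r` and `c` beyond `k` are irrelevant. -/
def InducedCycle {V : Type*} (R : V → V → Prop) (k : ℕ) (r c : ℕ → V) : Prop :=
  3 ≤ k ∧ ∀ i < k, ∀ j < k, (R (r i) (c j) ↔ j = i ∨ i = j + 1 ∨ (i = 0 ∧ j + 1 = k))

/-- The smallest row of the cycle and its two columns would form a `Γ` with one of the two
neighbouring rows. -/
lemma GammaFree.not_inducedCycle {V : Type*} {R : V → V → Prop} {f : V → ℕ}
    (hf : Function.Injective f) (h : GammaFree R f) {k : ℕ} {r c : ℕ → V} :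
    ¬ InducedCycle R k r c := by
  rintro ⟨hk, hc⟩
  obtain ⟨i, hi, hmin⟩ := Finset.exists_min_image (Finset.range k) (fun i => f (r i))
    ⟨0, by simp; omega⟩
  simp only [Finset.mem_range] at hi hmin
  have hlt : ∀ j < k, ∀ l < k, R (r j) (c l) → ¬ R (r i) (c l) → f (r i) < f (r j) := by
    intro j hj l _ h1 h2
    refine lt_of_le_of_ne (hmin j hj) fun h3 => h2 ?_
    rwa [hf h3]
  have hlt' : ∀ j < k, ∀ l < k, R (r i) (c l) → ¬ R (r j) (c l) → f (r i) < f (r j) := by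
    intro j hj l _ h1 h2
    refine lt_of_le_of_ne (hmin j hj) fun h3 => h2 ?_
    rwa [← hf h3]
  obtain ⟨p, hp, hpi⟩ : ∃ p < k, i = p + 1 ∨ (i = 0 ∧ p + 1 = k) :=
    if h0 : i = 0 then ⟨k - 1, by omega, by omega⟩ else ⟨i - 1, by omega, by omega⟩
  obtain ⟨q, hq, hqi⟩ : ∃ q < k, q = i + 1 ∨ (q = 0 ∧ i + 1 = k) :=
    if h0 : i + 1 = k then ⟨0, by omega, by omega⟩ else ⟨i + 1, by omega, by omega⟩
  have e1 : R (r i) (c i) := (hc i hi i hi).2 (by omega)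
  have e2 : R (r i) (c p) := (hc i hi p hp).2 (by omega)
  have e3 : R (r q) (c i) := (hc q hq i hi).2 (by omega)
  have e4 : R (r p) (c p) := (hc p hp p hp).2 (by omega)
  have n1 : ¬ R (r q) (c p) := fun h => by have := (hc q hq p hp).1 h; omega
  have n2 : ¬ R (r p) (c i) := fun h => by have := (hc p hp i hi).1 h; omega
  rcases lt_trichotomy (f (c i)) (f (c p)) with h1 | h1 | h1
  · exact n1 (h _ _ _ _ (hlt' q hq p hp e2 n1) h1 e1 e2 e3)
  · rw [hf h1] at e3; exact n1 e3
  · exact n2 (h _ _ _ _ (hlt' p hp i hi e1 n2) h1 e2 e1 e4)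

/-- The symmetric matrix `R` is doubly lexically ordered by `f`: of any two rows the later one is
the larger one when rows are compared at the last column `y` in which they differ. -/
def LexOrdered {V : Type*} (R : V → V → Prop) (f : V → ℕ) : Prop :=
  ∀ a b x, f a < f b → R a x → ¬ R b x →
    ∃ y, f x < f y ∧ R b y ∧ ¬ R a y ∧ ∀ z, f y < f z → (R a z ↔ R b z)

/-- With the vertex at position `i` weighted `2 ^ i`, let the ordering maximize the quadratic form
of the matrix. If row `a` preceded row `b` although its binary value is larger, exchanging
`a` and `b` would increase the form: the change is `2 δ (row a - row b) + δ² q`, where `δ > 0` is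
the difference of the weights and `q = R a a + R b b - R a b - R b a ≥ 0` because the diagonal
entries are `1`. -/
theorem exists_lexOrdered {V : Type*} [Fintype V] (R : V → V → Prop)
    (hrefl : ∀ a, R a a) (hsymm : ∀ a b, R a b → R b a) :
    ∃ σ : V ≃ Fin (Fintype.card V), LexOrdered R (fun a => (σ a : ℕ)) := by
  classical
  -- `Φ` is the quadratic form, `w σ` the vector of weights and, below, `δ * d` the change of the
  -- weights when `a` and `b` are exchanged.
  let M : V → V → ℤ := fun a b => if R a b then 1 else 0
  have hM : ∀ a b, M a b = M b a := fun a b => by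
    simp only [M]; congr 1; exact propext ⟨hsymm a b, hsymm b a⟩
  let Φ : (V → ℤ) → ℤ := fun x => ∑ a, ∑ b, M a b * x a * x b
  let w : (V ≃ Fin (Fintype.card V)) → V → ℤ := fun σ a => 2 ^ (σ a : ℕ)
  have : Nonempty (V ≃ Fin (Fintype.card V)) := ⟨Fintype.equivFin V⟩
  obtain ⟨σ, hσ⟩ := Finite.exists_max (fun σ => Φ (w σ))
  refine ⟨σ, ?_⟩
  have key : ∀ a b, (σ a : ℕ) < σ b → ∑ c, M a c * w σ c ≤ ∑ c, M b c * w σ c := by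
    intro a b hab
    by_contra! hlt
    have hne : a ≠ b := by rintro rfl; exact lt_irrefl _ hab
    set δ : ℤ := w σ b - w σ a with hδ
    have hδ0 : 0 < δ := sub_pos.2 (pow_lt_pow_right₀ (by norm_num) hab)
    let d : V → ℤ := fun c => if c = a then 1 else if c = b then -1 else 0
    have hw : ∀ c, w ((Equiv.swap a b).trans σ) c = w σ c + δ * d c := by
      intro c
      by_cases h1 : c = a
      · subst h1; simp [w, d, hδ]
      · by_cases h2 : c = b
        · subst h2; simp [w, d, hδ, h1]
        · simp [w, d, h1, h2, Equiv.swap_apply_of_ne_of_ne]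
    have hsum : ∀ g : V → ℤ, ∑ c, d c * g c = g a - g b := by
      intro g
      have : ∀ c, d c * g c = (if c = a then g c else 0) - (if c = b then g c else 0) := by
        intro c
        by_cases h1 : c = a
        · subst h1; simp [d, hne]
        · by_cases h2 : c = b
          · subst h2; simp [d, h1]
          · simp [d, h1, h2]
      simp [this, Finset.sum_sub_distrib]
    have hexp : Φ (w ((Equiv.swap a b).trans σ)) = Φ (w σ)
        + 2 * δ * (∑ c, M a c * w σ c - ∑ c, M b c * w σ c)
        + δ ^ 2 * (M a a + M b b - 2 * M a b) := by
      have h1 : ∑ p, d p * ∑ q, M p q * w σ q = ∑ c, M a c * w σ c - ∑ c, M b c * w σ c :=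
        hsum fun p => ∑ q, M p q * w σ q
      have h2 : ∑ p, d p * ∑ q, d q * M p q = M a a + M b b - 2 * M a b := by
        simp only [hsum, hM b a]; ring
      have h3 : ∑ p, ∑ q, M p q * w σ p * d q = ∑ p, d p * ∑ q, M p q * w σ q := by
        rw [Finset.sum_comm]
        refine Finset.sum_congr rfl fun p _ => ?_
        rw [Finset.mul_sum]
        refine Finset.sum_congr rfl fun q _ => ?_
        rw [hM q p]; ring
      have h4 : Φ (w ((Equiv.swap a b).trans σ)) = Φ (w σ)
          + δ * (∑ p, d p * ∑ q, M p q * w σ q) + δ * (∑ p, ∑ q, M p q * w σ p * d q)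
          + δ ^ 2 * (∑ p, d p * ∑ q, d q * M p q) := by
        simp only [Φ, hw, Finset.mul_sum, ← Finset.sum_add_distrib]
        refine Finset.sum_congr rfl fun p _ => Finset.sum_congr rfl fun q _ => ?_
        ring
      rw [h4, h3, h1, h2]; ring
    have hq : 0 ≤ M a a + M b b - 2 * M a b := by
      simp only [M, hrefl, if_true]; split_ifs <;> norm_num
    have := hσ ((Equiv.swap a b).trans σ)
    rw [hexp] at this
    nlinarith [mul_pos hδ0 (sub_pos.2 hlt), mul_nonneg (sq_nonneg δ) hq]
  -- Rows are compared as binary numbers, which is the colexicographic order of their supports `S`.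
  let S : V → Finset ℕ := fun a => (Finset.univ.filter (R a)).image (fun c => (σ c : ℕ))
  have hinj : Function.Injective (fun c => (σ c : ℕ)) :=
    Fin.val_injective.comp σ.injective
  have hS : ∀ a c, (σ c : ℕ) ∈ S a ↔ R a c := by
    intro a c
    simp only [S, Finset.mem_image, Finset.mem_filter, Finset.mem_univ, true_and]
    exact ⟨fun ⟨d, h1, h2⟩ => hinj h2 ▸ h1, fun h => ⟨c, h, rfl⟩⟩
  have hS' : ∀ a m, m ∈ S a → ∃ c, (σ c : ℕ) = m := by
    intro a m hm
    obtain ⟨c, _, h⟩ := Finset.mem_image.1 hm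
    exact ⟨c, h⟩
  have hval : ∀ a, ((∑ i ∈ S a, 2 ^ i : ℕ) : ℤ) = ∑ c, M a c * w σ c := by
    intro a
    rw [Finset.sum_image (fun _ _ _ _ h => hinj h)]
    simp [M, w, Finset.sum_filter]
  intro a b x hab hax hbx
  have hle : toColex (S a) ≤ toColex (S b) := by
    rw [← Finset.geomSum_le_geomSum_iff_toColex_le_toColex (le_refl 2)]
    have := key a b hab
    rw [← hval, ← hval] at this
    exact_mod_cast this
  rw [Finset.Colex.toColex_le_toColex] at hle
  have hne : (S b \ S a).Nonempty := by
    obtain ⟨y, h1, h2, _⟩ := hle ((hS a x).2 hax) (fun h => hbx ((hS b x).1 h))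
    exact ⟨y, by simp [h1, h2]⟩
  obtain ⟨m, hm, hmax⟩ := Finset.exists_max_image _ id hne
  simp only [Finset.mem_sdiff, id] at hm hmax
  obtain ⟨y, rfl⟩ := hS' _ _ hm.1
  have hup : ∀ z, R a z → ¬ R b z → (σ z : ℕ) ≤ σ y := by
    intro z h1 h2
    obtain ⟨t, h3, h4, h5⟩ := hle ((hS a z).2 h1) (fun h => h2 ((hS b z).1 h))
    exact h5.trans (hmax t ⟨h3, h4⟩)
  rw [hS, hS] at hm
  refine ⟨y, lt_of_le_of_ne (hup x hax hbx) ?_, hm.1, hm.2, fun z hz => ⟨fun h => ?_, fun h => ?_⟩⟩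
  · intro h
    rw [hinj h] at hbx
    exact hbx hm.1
  · by_contra h'
    exact absurd (hup z h h') (not_le.2 hz)
  · by_contra h'
    exact absurd (hmax (σ z) ⟨(hS b z).2 h, fun h6 => h' ((hS a z).1 h6)⟩) (not_le.2 hz)

end SCDel

/-! ### A doubly lexical ordering without induced cycles is Γ-free -/

namespace SCDel

/-- A ladder grown from a `Γ` in a doubly lexically ordered symmetric matrix: increasing rows
`r 0, …, r t` and increasing columns `c 0, …, c t` inducing the path
`…, r 3, c 2, r 1, c 0, r 0, c 1, r 2, c 3, …` with two ends at index `t`. The last four fields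
record that `r (s+2)` and `c (s+2)` were chosen as the last places in which two columns, or two
rows, differ. -/
structure Ladder {V : Type*} (R : V → V → Prop) (f : V → ℕ) (t : ℕ) (r c : ℕ → V) : Prop where
  row_lt : ∀ s < t, f (r s) < f (r (s + 1))
  col_lt : ∀ s < t, f (c s) < f (c (s + 1))
  zero : R (r 0) (c 0)
  edge : ∀ s < t, R (r s) (c (s + 1))
  edge' : ∀ s < t, R (r (s + 1)) (c s)
  diag : ∀ s, 1 ≤ s → s ≤ t → ¬ R (r s) (c s)
  skip : ∀ s, s + 2 ≤ t → ¬ R (r s) (c (s + 2))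
  skip' : ∀ s, s + 2 ≤ t → ¬ R (r (s + 2)) (c s)
  last : ∀ s, s + 2 ≤ t → ∀ z, f (c (s + 2)) < f z → (R (r s) z ↔ R (r (s + 1)) z)
  last' : ∀ s, s + 2 ≤ t → ∀ z, f (r (s + 2)) < f z → (R z (c s) ↔ R z (c (s + 1)))

variable {V : Type*} {R : V → V → Prop} {f : V → ℕ}

lemma lt_of_forall_lt_succ {g : ℕ → ℕ} {t : ℕ} (h : ∀ s < t, g s < g (s + 1)) :
    ∀ a b, a < b → b ≤ t → g a < g b := by
  intro a b hab
  induction b, hab using Nat.le_induction with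
  | base => intro hb; exact h a (by omega)
  | succ b hab ih => intro hb; exact (ih (by omega)).trans (h b (by omega))

/-- Beyond the last place in which two consecutive rows differ they agree, so that an entry `0` at
distance two from the diagonal is carried over from each row to the one before it. -/
lemma Ladder.not_rel_above {t : ℕ} {r c : ℕ → V} (h : Ladder R f t r c) :
    ∀ d s, s + 2 + d ≤ t → ¬ R (r s) (c (s + 2 + d)) := by
  intro d
  induction d with
  | zero => intro s hs; exact h.skip s hs
  | succ d ih =>
    intro s hs
    rw [h.last s (by omega) _
      (lt_of_forall_lt_succ (g := fun s => f (c s)) h.col_lt _ _ (by omega) hs)]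
    have := ih (s + 1) (by omega)
    rwa [show s + 1 + 2 + d = s + 2 + (d + 1) by omega] at this

lemma Ladder.not_rel_below {t : ℕ} {r c : ℕ → V} (h : Ladder R f t r c) :
    ∀ d s, s + 2 + d ≤ t → ¬ R (r (s + 2 + d)) (c s) := by
  intro d
  induction d with
  | zero => intro s hs; exact h.skip' s hs
  | succ d ih =>
    intro s hs
    rw [h.last' s (by omega) _
      (lt_of_forall_lt_succ (g := fun s => f (r s)) h.row_lt _ _ (by omega) hs)]
    have := ih (s + 1) (by omega)
    rwa [show s + 1 + 2 + d = s + 2 + (d + 1) by omega] at this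

lemma Ladder.rel_iff {t : ℕ} {r c : ℕ → V} (h : Ladder R f t r c) {a b : ℕ} (ha : a ≤ t)
    (hb : b ≤ t) : R (r a) (c b) ↔ b = a + 1 ∨ a = b + 1 ∨ (a = 0 ∧ b = 0) := by
  constructor
  · intro hr
    by_contra hn
    rcases lt_trichotomy a b with hab | hab | hab
    · obtain ⟨d, rfl⟩ := Nat.exists_eq_add_of_le (show a + 2 ≤ b by omega)
      exact h.not_rel_above d a hb hr
    · subst hab
      exact h.diag a (by omega) ha hr
    · obtain ⟨d, rfl⟩ := Nat.exists_eq_add_of_le (show b + 2 ≤ a by omega)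
      exact h.not_rel_below d b ha hr
  · rintro (rfl | rfl | ⟨rfl, rfl⟩)
    · exact h.edge a (by omega)
    · exact h.edge' b (by omega)
    · exact h.zero

/-- A ladder that cannot be closed to a cycle can be prolonged: by the last row `x` in which the
columns `c t`, `c (t + 1)` differ and the last column `y` in which the rows `r t`, `r (t + 1)`
differ. Hypothesis `hopen` excludes that `x` and `y` close the ladder. -/
lemma Ladder.extend {t : ℕ} {r c : ℕ → V} (hsymm : ∀ a b, R a b → R b a)
    (hlex : LexOrdered R f) (h : Ladder R f (t + 1) r c)
    (hopen : ∀ x y, R x (c (t + 1)) → ¬ R x (c t) → R (r (t + 1)) y → ¬ R (r t) y →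
      (∀ s ≤ t, ¬ R x (c s)) → (∀ s ≤ t, ¬ R (r s) y) → ¬ R x y) :
    ∃ r' c', Ladder R f (t + 2) r' c' := by
  obtain ⟨y, hy, hy1, hy2, hy3⟩ := hlex (r t) (r (t + 1)) (c (t + 1)) (h.row_lt t (by omega))
    (h.edge t (by omega)) (h.diag _ (by omega) le_rfl)
  obtain ⟨x, hx, hx1, hx2, hx3⟩ := hlex (c t) (c (t + 1)) (r (t + 1)) (h.col_lt t (by omega))
    (hsymm _ _ (h.edge' t (by omega))) (fun h' => h.diag _ (by omega) le_rfl (hsymm _ _ h'))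
  replace hx1 := hsymm _ _ hx1
  replace hx2 : ¬ R x (c t) := fun h' => hx2 (hsymm _ _ h')
  replace hx3 : ∀ z, f x < f z → (R z (c t) ↔ R z (c (t + 1))) := fun z hz =>
    ⟨fun h' => hsymm _ _ ((hx3 z hz).1 (hsymm _ _ h')),
      fun h' => hsymm _ _ ((hx3 z hz).2 (hsymm _ _ h'))⟩
  have hcy : ∀ s ≤ t + 1, f (c s) < f y := fun s hs => by
    rcases hs.lt_or_eq with hs | rfl
    · exact (lt_of_forall_lt_succ (g := fun s => f (c s)) h.col_lt _ _ hs le_rfl).trans hy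
    · exact hy
  have hrx : ∀ s ≤ t + 1, f (r s) < f x := fun s hs => by
    rcases hs.lt_or_eq with hs | rfl
    · exact (lt_of_forall_lt_succ (g := fun s => f (r s)) h.row_lt _ _ hs le_rfl).trans hx
    · exact hx
  have hfar : ∀ d s, s + d = t → ¬ R (r s) y := by
    intro d
    induction d with
    | zero => rintro s rfl; exact hy2
    | succ d ih =>
      intro s hs
      rw [h.last s (by omega) y (hcy _ (by omega))]
      exact ih (s + 1) (by omega)
  have hfar' : ∀ d s, s + d = t → ¬ R x (c s) := by
    intro d
    induction d with
    | zero => rintro s rfl; exact hx2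
    | succ d ih =>
      intro s hs
      rw [h.last' s (by omega) x (hrx _ (by omega))]
      exact ih (s + 1) (by omega)
  have hxy : ¬ R x y := hopen x y hx1 hx2 hy1 hy2
    (fun s hs => hfar' (t - s) s (by omega)) (fun s hs => hfar (t - s) s (by omega))
  let r' : ℕ → V := fun s => if s ≤ t + 1 then r s else x
  let c' : ℕ → V := fun s => if s ≤ t + 1 then c s else y
  have er : ∀ s, s ≤ t + 1 → r' s = r s := fun s hs => if_pos hs
  have ec : ∀ s, s ≤ t + 1 → c' s = c s := fun s hs => if_pos hs
  have er2 : r' (t + 2) = x := if_neg (by omega)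
  have ec2 : c' (t + 2) = y := if_neg (by omega)
  refine ⟨r', c', ?_, ?_, ?_, ?_, ?_, ?_, ?_, ?_, ?_, ?_⟩
  · intro s hs
    rcases eq_or_ne s (t + 1) with rfl | hne
    · rw [er2, er _ le_rfl]; exact hx
    · rw [er _ (by omega), er _ (by omega)]; exact h.row_lt s (by omega)
  · intro s hs
    rcases eq_or_ne s (t + 1) with rfl | hne
    · rw [ec2, ec _ le_rfl]; exact hy
    · rw [ec _ (by omega), ec _ (by omega)]; exact h.col_lt s (by omega)
  · rw [er _ (by omega), ec _ (by omega)]; exact h.zero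
  · intro s hs
    rcases eq_or_ne s (t + 1) with rfl | hne
    · rw [ec2, er _ le_rfl]; exact hy1
    · rw [er _ (by omega), ec _ (by omega)]; exact h.edge s (by omega)
  · intro s hs
    rcases eq_or_ne s (t + 1) with rfl | hne
    · rw [er2, ec _ le_rfl]; exact hx1
    · rw [er _ (by omega), ec _ (by omega)]; exact h.edge' s (by omega)
  · intro s hs1 hs
    rcases eq_or_ne s (t + 2) with rfl | hne
    · rw [er2, ec2]; exact hxy
    · rw [er _ (by omega), ec _ (by omega)]; exact h.diag s hs1 (by omega)
  · intro s hs
    rcases eq_or_ne s t with rfl | hne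
    · rw [ec2, er _ (by omega)]; exact hy2
    · rw [er _ (by omega), ec _ (by omega)]; exact h.skip s (by omega)
  · intro s hs
    rcases eq_or_ne s t with rfl | hne
    · rw [er2, ec _ (by omega)]; exact hx2
    · rw [er _ (by omega), ec _ (by omega)]; exact h.skip' s (by omega)
  · intro s hs
    rcases eq_or_ne s t with rfl | hne
    · rw [ec2, er _ (by omega), er _ (by omega)]; exact hy3
    · rw [er _ (by omega), er _ (by omega), ec _ (by omega)]; exact h.last s (by omega)
  · intro s hs
    rcases eq_or_ne s t with rfl | hne
    · rw [er2, ec _ (by omega), ec _ (by omega)]; exact hx3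
    · rw [er _ (by omega), ec _ (by omega), ec _ (by omega)]; exact h.last' s (by omega)

/-- A ladder whose ends are joined by a further adjacent row and column closes to an induced cycle. It
is traversed upwards along one rail, `r 0, c 1, r 2, …`, and downwards along the other one. -/
lemma Ladder.inducedCycle {t : ℕ} {r c : ℕ → V} (h : Ladder R f (t + 1) r c) {x y : V}
    (hx : R x (c (t + 1))) (hy : R (r (t + 1)) y) (hxs : ∀ s ≤ t, ¬ R x (c s))
    (hys : ∀ s ≤ t, ¬ R (r s) y) (hxy : R x y) : ∃ k r' c', InducedCycle R k r' c' := by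
  let r₁ : ℕ → V := fun s => if s ≤ t + 1 then r s else x
  let c₁ : ℕ → V := fun s => if s ≤ t + 1 then c s else y
  have hrel : ∀ a ≤ t + 2, ∀ b ≤ t + 2, (R (r₁ a) (c₁ b) ↔
      b = a + 1 ∨ a = b + 1 ∨ (a = 0 ∧ b = 0) ∨ (a = t + 2 ∧ b = t + 2)) := by
    intro a ha b hb
    rcases Nat.lt_or_ge (t + 1) a with ha' | ha' <;> rcases Nat.lt_or_ge (t + 1) b with hb' | hb'
    · simp only [r₁, c₁, if_neg (not_le.2 ha'), if_neg (not_le.2 hb'), hxy, true_iff]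
      omega
    · simp only [r₁, c₁, if_neg (not_le.2 ha'), if_pos hb']
      rcases hb'.lt_or_eq with hb2 | rfl
      · simp only [hxs b (by omega), false_iff]; omega
      · simp only [hx, true_iff]; omega
    · simp only [r₁, c₁, if_neg (not_le.2 hb'), if_pos ha']
      rcases ha'.lt_or_eq with ha2 | rfl
      · simp only [hys a (by omega), false_iff]; omega
      · simp only [hy, true_iff]; omega
    · simp only [r₁, c₁, if_pos ha', if_pos hb', h.rel_iff ha' hb']
      omega
  refine ⟨t + 3, fun i => r₁ (if 2 * i ≤ t + 2 then 2 * i else 2 * (t + 2) + 1 - 2 * i),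
    fun j => c₁ (if 2 * j + 1 ≤ t + 2 then 2 * j + 1 else 2 * (t + 2) - 2 * j), by omega, ?_⟩
  intro i hi j hj
  change R (r₁ _) (c₁ _) ↔ _
  rw [hrel _ (by split_ifs <;> omega) _ (by split_ifs <;> omega)]
  split_ifs <;> try simp only [and_false, false_or]
  all_goals omega

/-- Starting from a `Γ`, the ladder is prolonged until it closes to a cycle. -/
theorem LexOrdered.gammaFree [Fintype V] {N : ℕ} (hN : ∀ a, f a < N)
    (hsymm : ∀ a b, R a b → R b a) (hlex : LexOrdered R f)
    (hcyc : ∀ k r c, ¬ InducedCycle R k r c) : GammaFree R f := by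
  intro a b x y hab hxy hax hay hbx
  by_contra hby
  have hlad : ∀ t, ∃ r c, Ladder R f (t + 1) r c := by
    intro t
    induction t with
    | zero =>
      refine ⟨fun s => if s = 0 then a else b, fun s => if s = 0 then x else y, ?_⟩
      constructor
      · intro s hs; obtain rfl : s = 0 := by omega
        simpa using hab
      · intro s hs; obtain rfl : s = 0 := by omega
        simpa using hxy
      · exact hax
      · intro s hs; obtain rfl : s = 0 := by omega
        exact hay
      · intro s hs; obtain rfl : s = 0 := by omega
        exact hbx
      · intro s hs1 hs; obtain rfl : s = 1 := by omega
        exact hby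
      all_goals intro s hs; omega
    | succ t ih =>
      obtain ⟨r, c, h⟩ := ih
      refine h.extend hsymm hlex ?_
      intro x y hx _ hy _ hxs hys hxy
      obtain ⟨k, r', c', h'⟩ := h.inducedCycle hx hy hxs hys hxy
      exact hcyc k r' c' h'
  obtain ⟨r, c, h⟩ := hlad N
  have hge : ∀ s ≤ N + 1, s ≤ f (r s) := by
    intro s
    induction s with
    | zero => simp
    | succ s ih => intro hs; have := h.row_lt s (by omega); have := ih (by omega); omega
  have := hge (N + 1) le_rfl
  have := hN (r (N + 1))
  omega

end SCDel

/-! ### Strongly chordal graphs are those with a totally balanced neighbourhood matrix -/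

namespace SCDel

/-- The closed neighbourhood matrix of `G`. -/
def closedRel {V : Type*} (G : SimpleGraph V) (a b : V) : Prop := b ∈ closedNbhd G a

variable {V : Type*} {G : SimpleGraph V}

lemma closedRel_iff {a b : V} : closedRel G a b ↔ b = a ∨ G.Adj a b := Iff.rfl

lemma closedRel_symm (a b : V) (h : closedRel G a b) : closedRel G b a := by
  rcases h with h | h
  · exact Or.inl h.symm
  · exact Or.inr h.symm

/-- A graph is strongly chordal if and only if its closed neighbourhood matrix is totally
balanced. -/
theorem stronglyChordal_iff_forall_not_inducedCycle [Fintype V] :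
    StronglyChordal G ↔ ∀ k r c, ¬ InducedCycle (closedRel G) k r c := by
  constructor
  · rintro ⟨σ, hσ⟩ k r c
    refine GammaFree.not_inducedCycle (f := fun a => (σ.symm a : ℕ))
      (Fin.val_injective.comp σ.symm.injective) ?_
    intro a b x y hab hxy hax hay hbx
    have := hσ (σ.symm a) (σ.symm b) (σ.symm x) (σ.symm y) hab hxy
    simp only [Equiv.apply_symm_apply] at this
    exact this hax hay hbx
  · intro h
    obtain ⟨σ, hσ⟩ := exists_lexOrdered (closedRel G) (fun a => Or.inl rfl) closedRel_symm
    have hg := hσ.gammaFree (fun a => (σ a).isLt) closedRel_symm h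
    refine ⟨σ.symm, fun i j k l hij hkl h1 h2 h3 => ?_⟩
    exact hg (σ.symm i) (σ.symm j) (σ.symm k) (σ.symm l) (by simpa using hij)
      (by simpa using hkl) h1 h2 h3

/-- The case of length six, with the rows and columns named. -/
lemma inducedCycle_three {R : V → V → Prop} {a b d x y z : V} (ax : R a x) (bx : R b x)
    (bY : R b y) (dy : R d y) (dz : R d z) (az : R a z) (ay : ¬ R a y) (bz : ¬ R b z)
    (dx : ¬ R d x) :
    InducedCycle R 3 (fun i => if i = 0 then a else if i = 1 then b else d)
      (fun j => if j = 0 then x else if j = 1 then y else z) := by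
  refine ⟨le_rfl, fun i hi j hj => ?_⟩
  interval_cases i <;> interval_cases j <;> simp [*]

/-- A strongly chordal graph has no induced cycle of length four. -/
lemma StronglyChordal.adj_or_adj [Fintype V] (h : StronglyChordal G) {a b c d : V}
    (hab : G.Adj a b) (hbc : G.Adj b c) (hcd : G.Adj c d) (hda : G.Adj d a) (hac : a ≠ c)
    (hbd : b ≠ d) : G.Adj a c ∨ G.Adj b d := by
  by_contra! hn
  refine stronglyChordal_iff_forall_not_inducedCycle.1 h _ _ _
    (inducedCycle_three (a := a) (b := b) (d := c) (x := a) (y := c) (z := d) ?_ ?_ ?_ ?_ ?_ ?_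
      ?_ ?_ ?_) <;> simp only [closedRel_iff] <;> grind [SimpleGraph.adj_comm]

/-- Every six-cycle `u, x, y, v, y', x'` of a strongly chordal graph has a strong chord. -/
lemma StronglyChordal.strongChord_of_sixCycle [Fintype V] (h : StronglyChordal G)
    {u x y v y' x' : V} (h1 : G.Adj u x) (h2 : G.Adj x y) (h3 : G.Adj y v) (h4 : G.Adj v y')
    (h5 : G.Adj y' x') (h6 : G.Adj x' u) (huv : u ≠ v) (hxy : x ≠ y') (hyx : y ≠ x') :
    G.Adj u v ∨ G.Adj x y' ∨ G.Adj y x' := by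
  by_contra! hn
  refine stronglyChordal_iff_forall_not_inducedCycle.1 h _ _ _
    (inducedCycle_three (a := u) (b := y) (d := y') (x := x) (y := v) (z := x') ?_ ?_ ?_ ?_ ?_ ?_
      ?_ ?_ ?_) <;> simp only [closedRel_iff] <;> grind [SimpleGraph.adj_comm]

/-! ### Cutting an induced cycle along a chord -/

section Cut

variable {R R' : V → V → Prop} {k : ℕ} {r c : ℕ → V}

lemma InducedCycle.row_inj (h : InducedCycle R k r c) {i j : ℕ} (hi : i < k) (hj : j < k)
    (hij : r i = r j) : i = j := by
  obtain ⟨hk, h⟩ := h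
  have key : ∀ l < k, (l = i ∨ i = l + 1 ∨ (i = 0 ∧ l + 1 = k)) ↔
      (l = j ∨ j = l + 1 ∨ (j = 0 ∧ l + 1 = k)) := fun l hl => by
    rw [← h i hi l hl, ← h j hj l hl, hij]
  have h1 := key i hi
  have h2 := key j hj
  by_contra hne
  rcases Nat.eq_zero_or_pos i with rfl | hi0
  · have h3 := key (k - 1) (by omega)
    omega
  · have h3 := key (i - 1) (by omega)
    omega

lemma InducedCycle.col_inj (h : InducedCycle R k r c) {i j : ℕ} (hi : i < k) (hj : j < k)
    (hij : c i = c j) : i = j := by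
  obtain ⟨hk, h⟩ := h
  have key : ∀ l < k, (i = l ∨ l = i + 1 ∨ (l = 0 ∧ i + 1 = k)) ↔
      (j = l ∨ l = j + 1 ∨ (l = 0 ∧ j + 1 = k)) := fun l hl => by
    rw [← h l hl i hi, ← h l hl j hj, hij]
  have h1 := key i hi
  have h2 := key j hj
  have h0 := key 0 (by omega)
  by_contra hne
  rcases Nat.lt_or_ge (i + 1) k with hi0 | hi0
  · have h3 := key (i + 1) (by omega)
    omega
  · omega

/-- An induced cycle can be started at any of its rows. -/
lemma InducedCycle.rotate (h : InducedCycle R k r c) {p : ℕ} (hp : p < k) :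
    ∃ r' c', InducedCycle R k r' c' ∧ r' 0 = r p ∧ ∀ j < k, ∃ j' < k, c' j' = c j := by
  obtain ⟨hk, h⟩ := h
  refine ⟨fun i => r (if i + p < k then i + p else i + p - k),
    fun j => c (if j + p < k then j + p else j + p - k), ⟨hk, fun i hi j hj => ?_⟩, ?_, ?_⟩
  · change R (r _) (c _) ↔ _
    rw [h _ (by split_ifs <;> omega) _ (by split_ifs <;> omega)]
    split_ifs <;> omega
  · simp [hp]
  · intro j hj
    rcases Nat.lt_or_ge j p with hjp | hjp
    · refine ⟨j + k - p, by omega, ?_⟩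
      change c _ = c _
      rw [if_neg (by omega)]; congr 1; omega
    · refine ⟨j - p, by omega, ?_⟩
      change c _ = c _
      rw [if_pos (by omega)]; congr 1; omega

/-- An induced cycle can be traversed backwards from its first row. -/
lemma InducedCycle.reverse (h : InducedCycle R k r c) :
    InducedCycle R k (fun i => r (if i = 0 then 0 else k - i)) (fun j => c (k - 1 - j)) := by
  obtain ⟨hk, h⟩ := h
  refine ⟨hk, fun i hi j hj => ?_⟩
  change R (r _) (c _) ↔ _
  rw [h _ (by split_ifs <;> omega) _ (by omega)]
  generalize hm : (if i = 0 then 0 else k - i) = m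
  split_ifs at hm <;> omega

/-- If `R` has no induced cycles, an arc which becomes an induced cycle of `R` by a chord has
length three. -/
lemma InducedCycle.left_arc (h : InducedCycle R' k r c) (hsub : ∀ a b, R' a b → R a b)
    (hR : ∀ k r c, ¬ InducedCycle R k r c) {q : ℕ} (hq0 : 0 < q) (hqk : q + 1 < k)
    (hchord : R (r 0) (c q))
    (hno : ∀ i ≤ q, ∀ j ≤ q, R (r i) (c j) → R' (r i) (c j) ∨ (i = 0 ∧ j = q)) : q = 1 := by
  by_contra hq1
  refine hR (q + 1) r c ⟨by omega, fun i hi j hj => ⟨fun hr => ?_, fun hp => ?_⟩⟩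
  · rcases hno i (by omega) j (by omega) hr with h1 | h1
    · rw [h.2 i (by omega) j (by omega)] at h1; omega
    · omega
  · rcases hp with h1 | h1 | ⟨rfl, h1⟩
    · exact hsub _ _ ((h.2 i (by omega) j (by omega)).2 (by omega))
    · exact hsub _ _ ((h.2 i (by omega) j (by omega)).2 (by omega))
    · obtain rfl : j = q := by omega
      exact hchord

lemma InducedCycle.right_arc (h : InducedCycle R' k r c) (hsub : ∀ a b, R' a b → R a b)
    (hR : ∀ k r c, ¬ InducedCycle R k r c) {q : ℕ} (hq0 : 0 < q) (hqk : q + 1 < k)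
    (hchord : R (r 0) (c q))
    (hno : ∀ i < k, ∀ j < k, (i = 0 ∨ q < i) → q ≤ j → R (r i) (c j) →
      R' (r i) (c j) ∨ (i = 0 ∧ j = q)) : k = q + 2 := by
  by_contra hq1
  refine hR (k - q) (fun i => r (if i = 0 then 0 else q + i)) (fun j => c (q + j))
    ⟨by omega, fun i hi j hj => ⟨fun hr => ?_, fun hp => ?_⟩⟩
  · have hi' : (if i = 0 then 0 else q + i) < k := by split_ifs <;> omega
    rcases hno _ hi' (q + j) (by omega) (by split_ifs <;> omega) (by omega) hr with h1 | h1
    · rw [h.2 _ hi' _ (by omega)] at h1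
      generalize hm : (if i = 0 then 0 else q + i) = m at h1
      split_ifs at hm <;> omega
    · split_ifs at h1 <;> omega
  · change R (r _) (c _)
    by_cases h0 : i = 0 ∧ j = 0
    · obtain ⟨rfl, rfl⟩ := h0
      exact hchord
    · refine hsub _ _ ((h.2 _ (by split_ifs <;> omega) _ (by omega)).2 ?_)
      split_ifs <;> omega

end Cut

end SCDel

/-! ### Deleting an edge -/

namespace SCDel

variable {V : Type*} {G : SimpleGraph V} {u v : V}

lemma deleteEdge_adj {a b : V} : (deleteEdge G u v).Adj a b ↔
    G.Adj a b ∧ ¬ (a = u ∧ b = v) ∧ ¬ (a = v ∧ b = u) := by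
  simp [deleteEdge, SimpleGraph.deleteEdges_adj]

lemma closedRel_deleteEdge (huv : u ≠ v) {a b : V} : closedRel (deleteEdge G u v) a b ↔
    closedRel G a b ∧ ¬ (a = u ∧ b = v) ∧ ¬ (a = v ∧ b = u) := by
  simp only [closedRel_iff, deleteEdge_adj]
  grind

/-- `u, x, y, v, y', x'` is a six-cycle of `G` without the chords `{x, y'}` and `{y, x'}`. -/
structure IsBadHexagon (G : SimpleGraph V) (u v x y x' y' : V) : Prop where
  ux : G.Adj u x
  xy : G.Adj x y
  yv : G.Adj y v
  ux' : G.Adj u x'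
  xy' : G.Adj x' y'
  yv' : G.Adj y' v
  ne₁ : u ≠ y
  ne₂ : u ≠ y'
  ne₃ : v ≠ x
  ne₄ : v ≠ x'
  ne₅ : x ≠ x'
  ne₆ : x ≠ y'
  ne₇ : y ≠ x'
  ne₈ : y ≠ y'
  nadj : ¬ G.Adj x y'
  nadj' : ¬ G.Adj y x'

/-- The common neighbours of `u` and `v` are pairwise adjacent. -/
def CommonNbrsClique (G : SimpleGraph V) (u v : V) : Prop :=
  ∀ a b, G.Adj u a → G.Adj v a → G.Adj u b → G.Adj v b → a ≠ b → G.Adj a b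

/-- An induced six-cycle of the neighbourhood matrix of `G - {u, v}` through row `u` and the opposite
column `v`. If its rows and columns are distinct vertices it is an excluded six-cycle; coincidences
give nonadjacent common neighbours or an induced four-cycle. -/
lemma no_inducedCycle_three (huv : G.Adj u v)
    (hC4 : ∀ a b c d, G.Adj a b → G.Adj b c → G.Adj c d → G.Adj d a → a ≠ c → b ≠ d →
      G.Adj a c ∨ G.Adj b d)
    (hcl : CommonNbrsClique G u v) (hhex : ∀ x y x' y', ¬ IsBadHexagon G u v x y x' y')
    {r c : ℕ → V} (h : InducedCycle (closedRel (deleteEdge G u v)) 3 r c) (hr : r 0 = u)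
    (hc : c 1 = v) : False := by
  have hR := fun a b => closedRel_deleteEdge (G := G) huv.ne (a := a) (b := b)
  have e := h.2
  have h00 := (e 0 (by omega) 0 (by omega)).2 (by omega)
  have h02 := (e 0 (by omega) 2 (by omega)).2 (by omega)
  have h10 := (e 1 (by omega) 0 (by omega)).2 (by omega)
  have h11 := (e 1 (by omega) 1 (by omega)).2 (by omega)
  have h21 := (e 2 (by omega) 1 (by omega)).2 (by omega)
  have h22 := (e 2 (by omega) 2 (by omega)).2 (by omega)
  have n12 : ¬ _ := fun h' => by have := (e 1 (by omega) 2 (by omega)).1 h'; omega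
  have n20 : ¬ _ := fun h' => by have := (e 2 (by omega) 0 (by omega)).1 h'; omega
  have r1 : r 1 ≠ u := fun h' => by
    have := h.row_inj (i := 1) (j := 0) (by omega) (by omega) (h'.trans hr.symm)
    omega
  have r2 : r 2 ≠ u := fun h' => by
    have := h.row_inj (i := 2) (j := 0) (by omega) (by omega) (h'.trans hr.symm)
    omega
  have c0 : c 0 ≠ v := fun h' => by
    have := h.col_inj (i := 0) (j := 1) (by omega) (by omega) (h'.trans hc.symm)
    omega
  have c2 : c 2 ≠ v := fun h' => by
    have := h.col_inj (i := 2) (j := 1) (by omega) (by omega) (h'.trans hc.symm)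
    omega
  have r12 : r 1 ≠ r 2 := fun h' => by
    have := h.row_inj (i := 1) (j := 2) (by omega) (by omega) h'
    omega
  have c02 : c 0 ≠ c 2 := fun h' => by
    have := h.col_inj (i := 0) (j := 2) (by omega) (by omega) h'
    omega
  rw [hR, closedRel_iff] at h00 h02 h10 h11 h21 h22 n12 n20
  rw [hr] at h00 h02
  rw [hc] at h11 h21
  generalize r 1 = a at *
  generalize r 2 = b at *
  generalize c 0 = x at *
  generalize c 2 = z at *
  clear hR e h
  have s1 := fun p q => G.adj_comm p q
  have s2 := fun p => G.loopless.irrefl p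
  have k1 := hcl x b
  have k2 := hcl a z
  have k3 := hcl a b
  have k4 := hcl x z
  have q1 := hC4 u z b v
  have q2 := hC4 u x a v
  have hx := hhex x a z b
  clear hC4 hcl hhex
  have hx' : ¬ (G.Adj u x ∧ G.Adj x a ∧ G.Adj a v ∧ G.Adj u z ∧ G.Adj z b ∧ G.Adj b v ∧
      x ≠ b ∧ a ≠ z ∧ ¬ G.Adj x b ∧ ¬ G.Adj a z) := by
    rintro ⟨h1, h2, h3, h4, h5, h6, h7, h8, h9, h10⟩
    exact hx ⟨h1, h2, h3, h4, h5, h6, r1.symm, r2.symm, c0.symm, c2.symm, c02, h7, h8, r12,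
      h9, h10⟩
  clear hx
  by_cases hav : a = v
  · subst hav; grind
  by_cases hbv : b = v
  · subst hbv; grind
  by_cases hxu : x = u
  · subst hxu; grind
  by_cases hzu : z = u
  · subst hzu; grind
  grind

/-- An induced cycle of the neighbourhood matrix of `G - {u, v}` on which row `u` and column `v`
lie is cut by the chord between them into induced cycles of the neighbourhood matrix of `G`, which
have length four. If row `v` and column `u` lie on it too, they form a second chord. -/
lemma not_inducedCycle_of_row_col (huv : G.Adj u v)
    (hG : ∀ k r c, ¬ InducedCycle (closedRel G) k r c)
    (hC4 : ∀ a b c d, G.Adj a b → G.Adj b c → G.Adj c d → G.Adj d a → a ≠ c → b ≠ d →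
      G.Adj a c ∨ G.Adj b d)
    (hcl : CommonNbrsClique G u v) (hhex : ∀ x y x' y', ¬ IsBadHexagon G u v x y x' y')
    {k : ℕ} {r c : ℕ → V} (h : InducedCycle (closedRel (deleteEdge G u v)) k r c)
    (hr : r 0 = u) {q : ℕ} (hq : q < k) (hc : c q = v) : False := by
  have hR := fun a b => closedRel_deleteEdge (G := G) huv.ne (a := a) (b := b)
  have hsub : ∀ a b, closedRel (deleteEdge G u v) a b → closedRel G a b :=
    fun a b h => ((hR a b).1 h).1
  have hchord : closedRel G (r 0) (c q) := by rw [hr, hc]; exact Or.inr huv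
  have hn : ¬ closedRel (deleteEdge G u v) (r 0) (c q) := by rw [hR, hr, hc]; tauto
  have hk := h.1
  rw [h.2 0 (by omega) q hq] at hn
  have hq0 : 0 < q := by omega
  have hqk : q + 1 < k := by omega
  have hrow : ∀ i < k, r i = u → i = 0 := fun i hi h' =>
    h.row_inj hi (by omega) (h'.trans hr.symm)
  have hcol : ∀ j < k, c j = v → j = q := fun j hj h' => h.col_inj hj hq (h'.trans hc.symm)
  by_cases hB : ∃ p < k, ∃ t < k, r p = v ∧ c t = u
  · obtain ⟨p, hp, t, ht, hrp, hct⟩ := hB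
    -- Row `u` is adjacent to column `u`, and row `v` to column `v`, on the cycle.
    -- Reversing the cycle if necessary, column `u` follows row `u`.
    wlog ht0 : t = 0 generalizing r c p q t
    · have hut : t = 0 ∨ t + 1 = k := by
        have : closedRel (deleteEdge G u v) (r 0) (c t) := by rw [hr, hct]; exact Or.inl rfl
        have := (h.2 0 (by omega) t ht).1 this
        omega
      have e1 : ∀ j, j < k → k - 1 - (k - 1 - j) = j := fun j hj => by omega
      refine this h.reverse (q := k - 1 - q) hr (by omega) (by rw [e1 q hq, hc]) ?_ ?_
        (by omega) (by omega) ?_ ?_ (p := if p = 0 then 0 else k - p) (by split_ifs <;> omega)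
        (k - 1 - t) (by omega) ?_ (by rw [e1 t ht, hct]) (by omega)
      · rw [e1 q hq]; simpa using hchord
      · omega
      · intro i hi h'
        have := hrow _ (by split_ifs <;> omega) h'
        split_ifs at this <;> omega
      · intro j hj h'
        have := hcol _ (by omega) h'
        omega
      · rw [← hrp]; congr 1; split_ifs <;> omega
    subst ht0
    have hrow' : ∀ i < k, r i = v → i = p := fun i hi h' => h.row_inj hi hp (h'.trans hrp.symm)
    have hcol' : ∀ j < k, c j = u → j = 0 := fun j hj h' => h.col_inj hj ht (h'.trans hct.symm)
    have hex : ∀ i < k, ∀ j < k, closedRel G (r i) (c j) →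
        closedRel (deleteEdge G u v) (r i) (c j) ∨ (i = 0 ∧ j = q) ∨ (i = p ∧ j = 0) := by
      intro i hi j hj h'
      by_cases h1 : r i = u ∧ c j = v
      · exact Or.inr (Or.inl ⟨hrow i hi h1.1, hcol j hj h1.2⟩)
      by_cases h2 : r i = v ∧ c j = u
      · exact Or.inr (Or.inr ⟨hrow' i hi h2.1, hcol' j hj h2.2⟩)
      exact Or.inl ((hR _ _).2 ⟨h', h1, h2⟩)
    have hp0 : p ≠ 0 := by rintro rfl; exact huv.ne (hr.symm.trans hrp)
    have hpn : p ≠ 1 := by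
      rintro rfl
      have := (hR _ _).1 ((h.2 1 (by omega) 0 (by omega)).2 (by omega))
      exact this.2.2 ⟨hrp, hct⟩
    have hpq : p = q ∨ p = q + 1 := by
      have : closedRel (deleteEdge G u v) (r p) (c q) := by rw [hrp, hc]; exact Or.inl rfl
      have := (h.2 p hp q hq).1 this
      omega
    have hright : k = q + 2 := h.right_arc hsub hG hq0 hqk hchord fun i hi j hj _ hqj h' => by
      rcases hex i hi j hj h' with h1 | h1 | h1
      · exact Or.inl h1
      · exact Or.inr h1
      · omega
    rcases hpq with rfl | rfl
    · -- The chords do not cross. The part of the cycle between them has length four, and so the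
      -- cycle has length eight.
      have hp2 : p = 2 := by
        by_contra hp2
        refine hG p (fun i => r (if i = 0 then p else i)) c
          ⟨by omega, fun i hi j hj => ⟨fun h' => ?_, fun h' => ?_⟩⟩
        · have hi' : (if i = 0 then p else i) < k := by split_ifs <;> omega
          rcases hex _ hi' j (by omega) h' with h1 | h1 | h1
          · rw [h.2 _ hi' j (by omega)] at h1
            generalize hm : (if i = 0 then p else i) = m at h1
            split_ifs at hm <;> omega
          · generalize hm : (if i = 0 then p else i) = m at h1
            split_ifs at hm <;> omega
          · generalize hm : (if i = 0 then p else i) = m at h1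
            split_ifs at hm <;> omega
        · change closedRel G (r _) (c _)
          by_cases h0 : i = 0 ∧ j = 0
          · obtain ⟨rfl, rfl⟩ := h0
            simp only [if_true]
            rw [hrp, hct]; exact Or.inr huv.symm
          · refine hsub _ _ ((h.2 _ (by split_ifs <;> omega) _ (by omega)).2 ?_)
            generalize hm : (if i = 0 then p else i) = m
            split_ifs at hm <;> omega
      subst hp2
      subst hright
      have e1 := (hR _ _).1 ((h.2 0 (by omega) 3 (by omega)).2 (by omega))
      have e2 := (hR _ _).1 ((h.2 3 (by omega) 2 (by omega)).2 (by omega))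
      have e3 := (hR _ _).1 ((h.2 3 (by omega) 3 (by omega)).2 (by omega))
      have n1 : ¬ closedRel (deleteEdge G u v) (r 2) (c 3) := fun h' => by
        have := (h.2 2 (by omega) 3 (by omega)).1 h'; omega
      have n2 : ¬ closedRel (deleteEdge G u v) (r 3) (c 0) := fun h' => by
        have := (h.2 3 (by omega) 0 (by omega)).1 h'; omega
      have m1 : r 3 ≠ u := fun h' => by have := hrow _ (by omega) h'; omega
      have m2 : r 3 ≠ v := fun h' => by have := hrow' _ (by omega) h'; omega
      have m3 : c 3 ≠ u := fun h' => by have := hcol' _ (by omega) h'; omega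
      have m4 : c 3 ≠ v := fun h' => by have := hcol _ (by omega) h'; omega
      rw [hR, closedRel_iff] at n1 n2
      simp only [closedRel_iff, hr, hrp, hc, hct] at e1 e2 e3 n1 n2
      have := hC4 u (c 3) (r 3) v
      grind [SimpleGraph.adj_comm]
    · -- The chords cross, each piece that contains only one of them has length four, and the cycle
      -- has length six.
      have hq1 : q = 1 := h.left_arc hsub hG hq0 hqk hchord fun i hi j hj h' => by
        rcases hex i (by omega) j (by omega) h' with h1 | h1 | h1
        · exact Or.inl h1
        · exact Or.inr h1
        · omega
      subst hq1
      subst hright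
      exact no_inducedCycle_three huv hC4 hcl hhex h hr hc
  · have hex : ∀ i < k, ∀ j < k, closedRel G (r i) (c j) →
        closedRel (deleteEdge G u v) (r i) (c j) ∨ (i = 0 ∧ j = q) := by
      intro i hi j hj h'
      by_cases h1 : r i = u ∧ c j = v
      · exact Or.inr ⟨hrow i hi h1.1, hcol j hj h1.2⟩
      · exact Or.inl ((hR _ _).2 ⟨h', h1, fun h2 => hB ⟨i, hi, j, hj, h2⟩⟩)
    have hq1 : q = 1 := h.left_arc hsub hG hq0 hqk hchord fun i hi j hj =>
      hex i (by omega) j (by omega)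
    have hright : k = q + 2 := h.right_arc hsub hG hq0 hqk hchord fun i hi j hj _ _ =>
      hex i hi j hj
    subst hq1
    subst hright
    exact no_inducedCycle_three huv hC4 hcl hhex h hr hc

lemma deleteEdge_comm : deleteEdge G u v = deleteEdge G v u := by
  simp [deleteEdge, Sym2.eq_swap]

/-- Deleting an edge of a strongly chordal graph: local form of the characterization. -/
theorem stronglyChordal_deleteEdge_iff [Fintype V] (hG : StronglyChordal G) (huv : G.Adj u v) :
    StronglyChordal (deleteEdge G u v) ↔
      CommonNbrsClique G u v ∧ ∀ x y x' y', ¬ IsBadHexagon G u v x y x' y' := by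
  constructor
  · intro h
    refine ⟨fun a b hua hva hub hvb hab => ?_, fun x y x' y' hx => ?_⟩
    · have := h.adj_or_adj (a := u) (b := a) (c := v) (d := b)
      simp only [deleteEdge_adj] at this
      have h1 := hua.ne
      have h2 := hva.ne
      have h3 := hub.ne
      have h4 := hvb.ne
      have h5 := huv.ne
      have s1 := fun p q => G.adj_comm p q
      grind
    · have h1 := hx.ne₁
      have h2 := hx.ne₂
      have h3 := hx.ne₃
      have h4 := hx.ne₄
      have h5 := hx.nadj
      have h6 := hx.nadj'
      have huv' := huv.ne
      have := h.strongChord_of_sixCycle (u := u) (x := x) (y := y) (v := v) (y' := y') (x' := x')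
        (by simp [hx.ux, h3.symm, huv.ne])
        (by simp [hx.xy, h3.symm, hx.ux.ne.symm])
        (by simp [hx.yv, h1.symm, huv.ne.symm])
        (by simp [hx.yv'.symm, huv.ne.symm, h2.symm])
        (by simp [hx.xy'.symm, h2.symm, hx.ux'.ne.symm])
        (by simp [hx.ux'.symm, huv.ne, h4.symm])
        huv.ne hx.ne₆ hx.ne₇
      simp only [deleteEdge_adj] at this
      tauto
  · rintro ⟨hcl, hhex⟩
    have hG' := stronglyChordal_iff_forall_not_inducedCycle.1 hG
    rw [stronglyChordal_iff_forall_not_inducedCycle]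
    intro k r c h
    by_cases h1 : ∃ p < k, ∃ q < k, r p = u ∧ c q = v
    · obtain ⟨p, hp, q, hq, hrp, hcq⟩ := h1
      obtain ⟨r', c', h', hr', hc'⟩ := h.rotate hp
      obtain ⟨q', hq', hcq'⟩ := hc' q hq
      exact not_inducedCycle_of_row_col huv hG' (fun a b c d => hG.adj_or_adj) hcl hhex h'
        (hr'.trans hrp) hq' (hcq'.trans hcq)
    by_cases h2 : ∃ p < k, ∃ q < k, r p = v ∧ c q = u
    · obtain ⟨p, hp, q, hq, hrp, hcq⟩ := h2
      rw [deleteEdge_comm] at h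
      obtain ⟨r', c', h', hr', hc'⟩ := h.rotate hp
      obtain ⟨q', hq', hcq'⟩ := hc' q hq
      refine not_inducedCycle_of_row_col huv.symm hG' (fun a b c d => hG.adj_or_adj)
        (fun a b h1 h2 h3 h4 => hcl a b h2 h1 h4 h3) (fun x y x' y' hx => hhex y x y' x' ?_) h'
        (hr'.trans hrp) hq' (hcq'.trans hcq)
      exact ⟨hx.yv.symm, hx.xy.symm, hx.ux.symm, hx.yv'.symm, hx.xy'.symm, hx.ux'.symm, hx.ne₃,
        hx.ne₄, hx.ne₁, hx.ne₂, hx.ne₈, hx.ne₇, hx.ne₆, hx.ne₅, hx.nadj', hx.nadj⟩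
    refine hG' k r c ⟨h.1, fun i hi j hj => ?_⟩
    rw [← h.2 i hi j hj, closedRel_deleteEdge huv.ne]
    have h3 : ¬ (r i = u ∧ c j = v) := fun h3 => h1 ⟨i, hi, j, hj, h3⟩
    have h4 : ¬ (r i = v ∧ c j = u) := fun h4 => h2 ⟨i, hi, j, hj, h4⟩
    exact (and_iff_left ⟨h3, h4⟩).symm

end SCDel

/-! ### Six-cycles, pairs of `P4` paths and maximal cliques -/

namespace SCDel

variable {V : Type*} {G : SimpleGraph V} {u v : V}

/-- On a six-cycle the strong chords join opposite vertices. -/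
lemma isStrongChord_six_iff {c : Fin 6 → V} {x y : V} :
    IsStrongChord G c x y ↔ IsCycleIn G c ∧ ∃ i, c i = x ∧ c (i + 3) = y ∧ G.Adj x y := by
  have key : ∀ i j : Fin 6, (arcDist i j ≠ 1 ∧ Odd (arcDist i j)) ↔ j = i + 3 := by
    unfold arcDist; decide
  constructor
  · rintro ⟨-, -, hc, i, j, hi, hj, hadj, h⟩
    obtain rfl := (key i j).1 h
    exact ⟨hc, i, hi, hj, hadj⟩
  · rintro ⟨hc, i, hi, hj, hadj⟩
    exact ⟨by decide, le_rfl, hc, i, i + 3, hi, hj, hadj, (key i (i + 3)).2 rfl⟩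

lemma IsBadHexagon.isOnlyStrongChord {x y x' y' : V} (h : IsBadHexagon G u v x y x' y')
    (huv : G.Adj u v) : IsOnlyStrongChord G ![u, x, y, v, y', x'] u v := by
  have hc : IsCycleIn G ![u, x, y, v, y', x'] := by
    refine ⟨by norm_num, ?_, ?_⟩
    · have h1 := h.ux.ne
      have h2 := h.xy.ne
      have h3 := h.yv.ne
      have h4 := h.ux'.ne
      have h5 := h.xy'.ne
      have h6 := h.yv'.ne
      have := huv.ne
      obtain ⟨-, -, -, -, -, -, n1, n2, n3, n4, n5, n6, n7, n8, -, -⟩ := h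
      intro i j hij
      fin_cases i <;> fin_cases j <;> first | rfl | (exfalso; simp at hij; grind)
    · intro i
      fin_cases i
      · exact h.ux
      · exact h.xy
      · exact h.yv
      · exact h.yv'.symm
      · exact h.xy'.symm
      · exact h.ux'.symm
  refine ⟨isStrongChord_six_iff.2 ⟨hc, 0, rfl, rfl, huv⟩, fun p q hpq => ?_⟩
  obtain ⟨-, i, rfl, rfl, hadj⟩ := isStrongChord_six_iff.1 hpq
  fin_cases i
  · rfl
  · exact absurd hadj h.nadj
  · exact absurd hadj h.nadj'
  · exact Sym2.eq_swap
  · exact absurd hadj.symm h.nadj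
  · exact absurd hadj.symm h.nadj'

/-- Reading a six-cycle from the end `u` of its only strong chord. -/
lemma IsOnlyStrongChord.exists_isBadHexagon {c : Fin 6 → V} (h : IsOnlyStrongChord G c u v) :
    ∃ i, c i = u ∧ c (i + 3) = v ∧
      IsBadHexagon G u v (c (i + 1)) (c (i + 2)) (c (i + 5)) (c (i + 4)) := by
  obtain ⟨h1, h2⟩ := h
  obtain ⟨hc, i, rfl, rfl, hadj⟩ := isStrongChord_six_iff.1 h1
  have hinj := hc.2.1
  have hne : ∀ a b : Fin 6, a ≠ b → c (i + a) ≠ c (i + b) := fun a b hab h' =>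
    hab (add_left_cancel (hinj h'))
  have hne0 : ∀ b : Fin 6, 0 ≠ b → c i ≠ c (i + b) := fun b hb => by
    simpa using hne 0 b hb
  have hadj' : ∀ a : Fin 6, G.Adj (c (i + a)) (c (i + a + 1)) := fun a => hc.2.2 (i + a)
  have hch : ∀ a b : Fin 6, a ≠ 0 → a ≠ 3 → b = a + 3 → ¬ G.Adj (c (i + a)) (c (i + b)) := by
    intro a b ha0 ha3 hb hadj2
    subst hb
    have := h2 (c (i + a)) (c (i + (a + 3)))
      (isStrongChord_six_iff.2 ⟨hc, i + a, rfl, by rw [add_assoc], hadj2⟩)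
    rw [Sym2.eq_iff] at this
    rcases this with ⟨h3, -⟩ | ⟨h3, -⟩
    · exact hne0 a ha0.symm h3.symm
    · exact hne a 3 ha3 h3
  have e1 : i + 1 + 1 = i + 2 := by rw [add_assoc]; rfl
  have e2 : i + 2 + 1 = i + 3 := by rw [add_assoc]; rfl
  have e3 : i + 3 + 1 = i + 4 := by rw [add_assoc]; rfl
  have e4 : i + 4 + 1 = i + 5 := by rw [add_assoc]; rfl
  have e5 : i + 5 + 1 = i := by rw [add_assoc]; exact add_zero i
  refine ⟨i, rfl, rfl, ?_⟩
  exact {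
    ux := hc.2.2 i
    xy := e1 ▸ hadj' 1
    yv := e2 ▸ hadj' 2
    yv' := (e3 ▸ hadj' 3).symm
    xy' := (e4 ▸ hadj' 4).symm
    ux' := (e5 ▸ hadj' 5).symm
    ne₁ := hne0 2 (by decide)
    ne₂ := hne0 4 (by decide)
    ne₃ := hne 3 1 (by decide)
    ne₄ := hne 3 5 (by decide)
    ne₅ := hne 1 5 (by decide)
    ne₆ := hne 1 4 (by decide)
    ne₇ := hne 2 5 (by decide)
    ne₈ := hne 2 4 (by decide)
    nadj := hch 1 4 (by decide) (by decide) (by decide)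
    nadj' := hch 2 5 (by decide) (by decide) (by decide) }

lemma exists_isOnlyStrongChord_iff (huv : G.Adj u v) :
    (∃ c : Fin 6 → V, IsOnlyStrongChord G c u v) ↔
      ∃ x y x' y', IsBadHexagon G u v x y x' y' := by
  constructor
  · rintro ⟨c, hc⟩
    obtain ⟨i, -, -, h⟩ := hc.exists_isBadHexagon
    exact ⟨_, _, _, _, h⟩
  · rintro ⟨x, y, x', y', h⟩
    exact ⟨_, h.isOnlyStrongChord huv⟩

lemma mem_auxNodes {w : V} : w ∈ auxNodes G u v ↔ w = u ∨ w = v ∨ G.Adj u w ∨ G.Adj v w := by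
  simp only [auxNodes, closedNbhd, Set.mem_union, Set.mem_insert_iff, SimpleGraph.mem_neighborSet]
  tauto

lemma hasBadP4Pair_iff (huv : G.Adj u v) :
    HasBadP4Pair G u v ↔ ∃ x y x' y', IsBadHexagon G u v x y x' y' := by
  constructor
  · rintro ⟨a, b, x, y, x', y', ha, hb, h1, h2, n1, n2, n3, n4, hc⟩
    have hne : ∀ p q : auxNodes G u v, p ≠ q → (p : V) ≠ q := fun p q h h' =>
      h (Subtype.ext h')
    have hcyc := (isStrongChord_six_iff.1 hc.1).1
    suffices hH : IsBadHexagon G (a : V) b x y x' y' by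
      rw [ha, hb] at hH
      exact ⟨x, y, x', y', hH⟩
    refine ⟨h1.1, h1.2.1, h1.2.2.1, h2.1, h2.2.1, h2.2.2.1, hne _ _ h1.2.2.2.1,
      hne _ _ h2.2.2.2.1, hne _ _ h1.2.2.2.2.2.symm, hne _ _ h2.2.2.2.2.2.symm, hne _ _ n1,
      hne _ _ n2, hne _ _ n3, hne _ _ n4, fun h => ?_, fun h => ?_⟩
    · have := hc.2 x y' (isStrongChord_six_iff.2 ⟨hcyc, 1, rfl, rfl, h⟩)
      rw [Sym2.eq_iff] at this
      rcases this with ⟨h3, -⟩ | ⟨h3, -⟩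
      · exact h1.1.ne h3.symm
      · exact h1.2.2.2.2.2 h3
    · have := hc.2 y x' (isStrongChord_six_iff.2 ⟨hcyc, 2, rfl, rfl, h⟩)
      rw [Sym2.eq_iff] at this
      rcases this with ⟨h3, -⟩ | ⟨h3, -⟩
      · exact h1.2.2.2.1 h3.symm
      · exact h1.2.2.1.ne h3
  · rintro ⟨x, y, x', y', h⟩
    have m : ∀ w, w = u ∨ w = v ∨ G.Adj u w ∨ G.Adj v w → w ∈ auxNodes G u v :=
      fun w => mem_auxNodes.2
    let a : auxNodes G u v := ⟨u, m _ (by simp)⟩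
    let b : auxNodes G u v := ⟨v, m _ (by simp)⟩
    let X : auxNodes G u v := ⟨x, m _ (by simp [h.ux])⟩
    let Y : auxNodes G u v := ⟨y, m _ (by simp [h.yv.symm])⟩
    let X' : auxNodes G u v := ⟨x', m _ (by simp [h.ux'])⟩
    let Y' : auxNodes G u v := ⟨y', m _ (by simp [h.yv'.symm])⟩
    have ne : ∀ p q : auxNodes G u v, (p : V) ≠ q → p ≠ q := fun p q hpq hpq' =>
      hpq (congrArg _ hpq')
    have hH : IsBadHexagon (G.induce (auxNodes G u v)) a b X Y X' Y' :=
      ⟨h.ux, h.xy, h.yv, h.ux', h.xy', h.yv', ne _ _ h.ne₁, ne _ _ h.ne₂, ne _ _ h.ne₃,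
        ne _ _ h.ne₄, ne _ _ h.ne₅, ne _ _ h.ne₆, ne _ _ h.ne₇, ne _ _ h.ne₈, h.nadj, h.nadj'⟩
    exact ⟨a, b, X, Y, X', Y', rfl, rfl,
      ⟨hH.ux, hH.xy, hH.yv, hH.ne₁, ne _ _ huv.ne, hH.ne₃.symm⟩,
      ⟨hH.ux', hH.xy', hH.yv', hH.ne₂, ne _ _ huv.ne, hH.ne₄.symm⟩,
      hH.ne₅, hH.ne₆, hH.ne₇, hH.ne₈, hH.isOnlyStrongChord huv⟩

lemma exists_isMaxClique_of_isClique [Finite V] {S : Finset V} (hS : G.IsClique (S : Set V)) :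
    ∃ K, S ⊆ K ∧ IsMaxClique G K := by
  obtain ⟨K, hSK, hK⟩ := (Set.toFinite {S : Finset V | G.IsClique (S : Set V)}).exists_le_maximal hS
  exact ⟨K, hSK, hK⟩

lemma existsUnique_isMaxClique_iff [Fintype V] (huv : G.Adj u v) :
    (∃! K : Finset V, IsMaxClique G K ∧ u ∈ K ∧ v ∈ K) ↔ CommonNbrsClique G u v := by
  classical
  constructor
  · rintro ⟨K, -, huniq⟩ a b hua hva hub hvb hab
    have key : ∀ w, G.Adj u w → G.Adj v w → w ∈ K := by
      intro w h1 h2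
      obtain ⟨K', hs, hK'⟩ := exists_isMaxClique_of_isClique (G := G) (S := {u, v, w}) (by
        rw [SimpleGraph.isClique_iff, Set.Pairwise]
        simp only [Finset.coe_insert, Finset.coe_singleton, Set.mem_insert_iff,
          Set.mem_singleton_iff]
        grind [SimpleGraph.adj_comm])
      have := huniq K' ⟨hK', hs (by simp), hs (by simp)⟩
      exact this ▸ hs (by simp)
    obtain ⟨K', hs, hK'⟩ := exists_isMaxClique_of_isClique (G := G) (S := {u, v}) (by
        rw [SimpleGraph.isClique_iff, Set.Pairwise]
        simp only [Finset.coe_insert, Finset.coe_singleton, Set.mem_insert_iff,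
          Set.mem_singleton_iff]
        grind [SimpleGraph.adj_comm])
    obtain rfl := huniq K' ⟨hK', hs (by simp), hs (by simp)⟩
    exact hK'.1 (key a hua hva) (key b hub hvb) hab
  · intro h
    let K : Finset V := Finset.univ.filter
      (fun w => w = u ∨ w = v ∨ (G.Adj u w ∧ G.Adj v w))
    have hmem : ∀ w, w ∈ K ↔ w = u ∨ w = v ∨ (G.Adj u w ∧ G.Adj v w) := fun w => by simp [K]
    have hsub : ∀ S : Finset V, G.IsClique (S : Set V) → u ∈ S → v ∈ S → S ⊆ K := by
      intro S hS hu hv w hw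
      rw [hmem]
      by_cases h1 : w = u
      · exact Or.inl h1
      by_cases h2 : w = v
      · exact Or.inr (Or.inl h2)
      exact Or.inr (Or.inr ⟨hS hu hw (Ne.symm h1), hS hv hw (Ne.symm h2)⟩)
    have hK : G.IsClique (K : Set V) := by
      intro a ha b hb hab
      have ha := (hmem a).1 ha
      have hb := (hmem b).1 hb
      have := h a b
      grind [SimpleGraph.adj_comm]
    have hu : u ∈ K := (hmem u).2 (by simp)
    have hv : v ∈ K := (hmem v).2 (by simp)
    refine ⟨K, ⟨⟨hK, fun S hS hKS => hsub S hS (hKS hu) (hKS hv)⟩, hu, hv⟩, ?_⟩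
    rintro S ⟨hS, hu', hv'⟩
    exact hS.eq_of_le hK (hsub S hS.1 hu' hv')

lemma IsCliqueTree.existsUnique_iff {ι : Type*} {K : ι → Finset V} {T : SimpleGraph ι}
    (h : IsCliqueTree G K T) :
    (∃! S : Finset V, IsMaxClique G S ∧ u ∈ S ∧ v ∈ S) ↔ ∃! i : ι, u ∈ K i ∧ v ∈ K i := by
  constructor
  · rintro ⟨S, ⟨hS, hu, hv⟩, huniq⟩
    obtain ⟨i, rfl⟩ := (h.range_eq S).2 hS
    exact ⟨i, ⟨hu, hv⟩, fun j hj => h.injective (huniq _ ⟨(h.range_eq _).1 ⟨j, rfl⟩, hj⟩)⟩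
  · rintro ⟨i, ⟨hu, hv⟩, huniq⟩
    refine ⟨K i, ⟨(h.range_eq _).1 ⟨i, rfl⟩, hu, hv⟩, ?_⟩
    rintro S ⟨hS, hS'⟩
    obtain ⟨j, rfl⟩ := (h.range_eq S).2 hS
    rw [huniq j hS']

/-- When an edge of a strongly chordal graph can be deleted, in terms of maximal cliques and
six-cycles. -/
theorem stronglyChordal_deleteEdge_iff_maxClique [Fintype V] (hG : StronglyChordal G)
    (huv : G.Adj u v) :
    StronglyChordal (deleteEdge G u v) ↔
      (∃! K : Finset V, IsMaxClique G K ∧ u ∈ K ∧ v ∈ K) ∧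
        ¬ ∃ c : Fin 6 → V, IsOnlyStrongChord G c u v := by
  rw [stronglyChordal_deleteEdge_iff hG huv, existsUnique_isMaxClique_iff huv,
    exists_isOnlyStrongChord_iff huv]
  push Not
  rfl

/-- In a strongly chordal graph a maximal clique is determined by its first vertex `w` in the
elimination ordering, since `w` and its later neighbours form a clique. So distinct maximal cliques
have distinct first vertices, and the total size is at most `∑ w, (1 + deg w)`. -/
lemma StronglyChordal.sum_card_maxClique_le [Fintype V] [Nonempty V] [DecidableRel G.Adj]
    (hG : StronglyChordal G) {ι : Type*} [Fintype ι] {K : ι → Finset V}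
    (hinj : Function.Injective K) (hK : ∀ i, IsMaxClique G (K i)) :
    ∑ i, (K i).card ≤ Fintype.card V + 2 * G.edgeFinset.card := by
  classical
  obtain ⟨σ, hσ⟩ := hG
  have hne : ∀ i, (K i).Nonempty := by
    intro i
    by_contra h
    rw [Finset.not_nonempty_iff_eq_empty] at h
    obtain ⟨w⟩ := ‹Nonempty V›
    have := (hK i).2 (y := {w}) (by simp) (by simp [h])
    simp [h] at this
  have hex : ∀ i, ∃ w ∈ K i, ∀ x ∈ K i, σ.symm w ≤ σ.symm x := fun i =>
    Finset.exists_min_image _ _ (hne i)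
  choose first hfirst hmin using hex
  have hsub : ∀ i, ∀ x ∈ K i, x = first i ∨ G.Adj (first i) x := by
    intro i x hx
    by_cases h : x = first i
    · exact Or.inl h
    · exact Or.inr ((hK i).1 (hfirst i) hx (Ne.symm h))
  have hfi : Function.Injective first := by
    intro i j hij
    let S : Finset V := Finset.univ.filter fun x =>
      (x = first i ∨ G.Adj (first i) x) ∧ σ.symm (first i) ≤ σ.symm x
    have hS : G.IsClique (S : Set V) := by
      intro a ha b hb hab
      wlog hlt : σ.symm a < σ.symm b generalizing a b
      · exact (this hb ha hab.symm (lt_of_le_of_ne (not_lt.1 hlt)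
          fun h => hab (σ.symm.injective h).symm)).symm
      simp only [S, Finset.coe_filter, Finset.mem_univ, true_and, Set.mem_ofPred_eq] at ha hb
      rcases ha.1 with rfl | ha1
      · rcases hb.1 with rfl | hb1
        · exact absurd rfl hab
        · exact hb1
      have hlt' : σ.symm (first i) < σ.symm a := lt_of_le_of_ne ha.2 fun h =>
        ha1.ne (σ.symm.injective h)
      have := hσ (σ.symm (first i)) (σ.symm a) (σ.symm (first i)) (σ.symm b) hlt'
        (hlt'.trans hlt)
      simp only [Equiv.apply_symm_apply] at this
      have h2 := this (Or.inl rfl) hb.1 (Or.inr ha1.symm)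
      exact h2.resolve_left hab.symm
    have h1 : K i = S := (hK i).eq_of_le hS fun x hx => by
      simp only [S, Finset.mem_filter, Finset.mem_univ, true_and]
      exact ⟨hsub i x hx, hmin i x hx⟩
    have h2 : K j = S := (hK j).eq_of_le hS fun x hx => by
      simp only [S, Finset.mem_filter, Finset.mem_univ, true_and]
      rw [hij]
      exact ⟨hsub j x hx, hmin j x hx⟩
    exact hinj (h1.trans h2.symm)
  calc ∑ i, (K i).card ≤ ∑ i, (1 + G.degree (first i)) := by
        refine Finset.sum_le_sum fun i _ => ?_
        have : K i ⊆ insert (first i) (G.neighborFinset (first i)) := fun x hx => by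
          rcases hsub i x hx with h | h <;> simp [h]
        have := (Finset.card_le_card this).trans (Finset.card_insert_le _ _)
        rw [SimpleGraph.card_neighborFinset_eq_degree] at this
        omega
    _ = ∑ w ∈ Finset.univ.image first, (1 + G.degree w) :=
        (Finset.sum_image (f := fun w => 1 + G.degree w) fun _ _ _ _ h => hfi h).symm
    _ ≤ ∑ w, (1 + G.degree w) := Finset.sum_le_univ_sum_of_nonneg fun _ => Nat.zero_le _
    _ = Fintype.card V + 2 * G.edgeFinset.card := by
        rw [Finset.sum_add_distrib, SimpleGraph.sum_degrees_eq_twice_card_edges]; simp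

end SCDel

/-! ### Reasoning about programs -/

namespace SCDel

section Semantics

variable (s : State)

@[simp] lemma State.setReg_reg (r r' : Reg) (k : ℕ) :
    (s.setReg r k).reg r' = if r' = r then k else s.reg r' := rfl

@[simp] lemma State.setReg_cell (r : Reg) (k : ℕ) : (s.setReg r k).cell = s.cell := rfl

@[simp] lemma State.setCell_reg (a : Arr) (p q k : ℕ) : (s.setCell a p q k).reg = s.reg := rfl

@[simp] lemma State.setCell_cell (a a' : Arr) (p q k p' q' : ℕ) : (s.setCell a p q k).cell a' p' q' =
    if a' = a ∧ p' = p ∧ q' = q then k else s.cell a' p' q' := rfl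

@[simp] lemma Prog.out_set (r : Reg) (e : Expr) :
    (Prog.set r e).out s = s.setReg r (e.eval s) := rfl
@[simp] lemma Prog.time_set (r : Reg) (e : Expr) : (Prog.set r e).time s = e.cost + 1 := rfl
@[simp] lemma Prog.out_store (a : Arr) (p q e : Expr) :
    (Prog.store a p q e).out s = s.setCell a (p.eval s) (q.eval s) (e.eval s) := rfl
@[simp] lemma Prog.time_store (a : Arr) (p q e : Expr) :
    (Prog.store a p q e).time s = p.cost + q.cost + e.cost + 1 := rfl
@[simp] lemma out_block_nil : (block []).out s = s := rfl
@[simp] lemma time_block_nil : (block []).time s = 0 := rfl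
@[simp] lemma out_block_cons (c : Prog) (cs : List Prog) :
    (block (c :: cs)).out s = (block cs).out (c.out s) := rfl
@[simp] lemma time_block_cons (c : Prog) (cs : List Prog) :
    (block (c :: cs)).time s = c.time s + (block cs).time (c.out s) := rfl
@[simp] lemma out_when (t : Test) (c : Prog) :
    (when t c).out s = if t.eval s then c.out s else s := by
  unfold when Prog.out; simp only [Prog.run]; split_ifs <;> rfl
@[simp] lemma time_when (t : Test) (c : Prog) :
    (when t c).time s = (if t.eval s then c.time s else 0) + t.cost + 1 := by
  unfold when Prog.time; simp only [Prog.run]; split_ifs <;> rfl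
@[simp] lemma out_incr (r : Reg) : (incr r).out s = s.setReg r (s.reg r + 1) := rfl
@[simp] lemma time_incr (r : Reg) : (incr r).time s = 3 := rfl
@[simp] lemma eval_adjTest (a b : Reg) :
    (adjTest a b).eval s = decide (s.cell .adj (s.reg a) (s.reg b) = 1) := rfl
@[simp] lemma cost_adjTest (a b : Reg) : (adjTest a b).cost = 5 := rfl
@[simp] lemma eval_sameTest (a b : Reg) :
    (sameTest a b).eval s = decide (s.reg a = s.reg b) := rfl
@[simp] lemma cost_sameTest (a b : Reg) : (sameTest a b).cost = 3 := rfl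

attribute [simp] Expr.eval Expr.cost Test.eval Test.cost

/-- The loop rule: `Inv k` holds before iteration `k`, and iteration `k` takes at most `B k`
steps. -/
lemma Prog.loop_spec {s : State} {r : Reg} {e : Expr} {c : Prog} (Inv : ℕ → State → Prop)
    (B : ℕ → ℕ) (h0 : Inv 0 s)
    (hs : ∀ k < e.eval s, ∀ s', Inv k s' →
      Inv (k + 1) (c.out (s'.setReg r k)) ∧ c.time (s'.setReg r k) ≤ B k) :
    Inv (e.eval s) ((Prog.loop r e c).out s) ∧
      (Prog.loop r e c).time s ≤ ∑ k ∈ Finset.range (e.eval s), (B k + 1) + e.cost + 1 := by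
  have key : ∀ N ≤ e.eval s, Inv N (iterate (fun k s' => c.run (s'.setReg r k)) N s).1 ∧
      (iterate (fun k s' => c.run (s'.setReg r k)) N s).2 ≤ ∑ k ∈ Finset.range N, (B k + 1) := by
    intro N
    induction N with
    | zero => intro _; exact ⟨h0, le_rfl⟩
    | succ N ih =>
      intro hN
      obtain ⟨h1, h2⟩ := ih (by omega)
      obtain ⟨h3, h4⟩ := hs N (by omega) _ h1
      refine ⟨h3, ?_⟩
      rw [Finset.sum_range_succ]
      simp only [iterate]
      simp only [Prog.time] at h4
      omega
  obtain ⟨h1, h2⟩ := key _ le_rfl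
  refine ⟨h1, ?_⟩
  simp only [Prog.time, Prog.run]
  omega

end Semantics

/-- The registers and arrays which hold the input are the same in both states. -/
structure SameInput (s s' : State) : Prop where
  n : s'.reg .n = s.reg .n
  u : s'.reg .u = s.reg .u
  v : s'.reg .v = s.reg .v
  nodes : s'.reg .nodes = s.reg .nodes
  adj : ∀ p q, s'.cell .adj p q = s.cell .adj p q
  size : ∀ p q, s'.cell .size p q = s.cell .size p q
  node : ∀ p q, s'.cell .node p q = s.cell .node p q

lemma SameInput.trans {s s' s'' : State} (h : SameInput s s') (h' : SameInput s' s'') :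
    SameInput s s'' :=
  ⟨h'.n.trans h.n, h'.u.trans h.u, h'.v.trans h.v, h'.nodes.trans h.nodes,
    fun p q => (h'.adj p q).trans (h.adj p q), fun p q => (h'.size p q).trans (h.size p q),
    fun p q => (h'.node p q).trans (h.node p q)⟩

lemma card_filter_range_succ (P : ℕ → Prop) [DecidablePred P] (k : ℕ) :
    ((Finset.range (k + 1)).filter P).card =
      ((Finset.range k).filter P).card + if P k then 1 else 0 := by
  rw [Finset.range_add_one, Finset.filter_insert]
  split_ifs <;> simp

/-- The number of entries of the `i`-th stored clique tree node that are equal to `u` or `v`. -/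
def hitCount (s : State) (i : ℕ) : ℕ :=
  ((Finset.range (s.cell .size 0 i)).filter
    fun j => s.cell .node i j = s.reg .u ∨ s.cell .node i j = s.reg .v).card

lemma countNodes_spec (s : State) :
    SameInput s (countNodes.out s) ∧ (countNodes.out s).reg .answer = s.reg .answer ∧
      (countNodes.out s).reg .count =
        ((Finset.range (s.reg .nodes)).filter fun i => hitCount s i = 2).card ∧
      countNodes.time s ≤
        4 + ∑ i ∈ Finset.range (s.reg .nodes), (16 * s.cell .size 0 i + 20) := by
  let s₀ := s.setReg .count 0
  let body : Prog := block [
    .set .hits (.lit 0),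
    .loop .j (.cell .size (.lit 0) (.reg .i))
      (when (.or (.eq (.cell .node (.reg .i) (.reg .j)) (.reg .u))
                 (.eq (.cell .node (.reg .i) (.reg .j)) (.reg .v)))
        (incr .hits)),
    when (.eq (.reg .hits) (.lit 2)) (incr .count)]
  have hloop := Prog.loop_spec (s := s₀) (r := .i) (e := .reg .nodes) (c := body)
    (fun k s' => SameInput s s' ∧ s'.reg .answer = s.reg .answer ∧
      s'.reg .count = ((Finset.range k).filter fun i => hitCount s i = 2).card)
    (fun i => 16 * s.cell .size 0 i + 19)
    ⟨⟨rfl, rfl, rfl, rfl, fun _ _ => rfl, fun _ _ => rfl, fun _ _ => rfl⟩, rfl, rfl⟩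
    (by
      rintro i - s' ⟨hsame, hans, hcount⟩
      have hin := Prog.loop_spec (s := (s'.setReg .i i).setReg .hits 0) (r := .j)
        (e := .cell .size (.lit 0) (.reg .i))
        (c := when (.or (.eq (.cell .node (.reg .i) (.reg .j)) (.reg .u))
                 (.eq (.cell .node (.reg .i) (.reg .j)) (.reg .v))) (incr .hits))
        (fun k s'' => SameInput s s'' ∧ s''.reg .answer = s.reg .answer ∧
          s''.reg .count = s'.reg .count ∧ s''.reg .i = i ∧
          s''.reg .hits = ((Finset.range k).filter fun j =>
            s.cell .node i j = s.reg .u ∨ s.cell .node i j = s.reg .v).card)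
        (fun _ => 15)
        ⟨⟨hsame.n, hsame.u, hsame.v, hsame.nodes, hsame.adj, hsame.size, hsame.node⟩,
          hans, rfl, rfl, rfl⟩
        (by
          rintro j - s'' ⟨h1, h2, h3, h4, h5⟩
          have e1 := h1.node i j
          have e2 := h1.u
          have e3 := h1.v
          constructor
          · rw [card_filter_range_succ]
            by_cases hP : s.cell .node i j = s.reg .u ∨ s.cell .node i j = s.reg .v
            · refine ⟨⟨?_, ?_, ?_, ?_, ?_, ?_, ?_⟩, ?_, ?_, ?_, ?_⟩ <;>
                simp [h4, h5, e1, e2, e3, hP, h1.n, h1.nodes, h1.adj, h1.size, h1.node,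
                  h2, h3]
            · refine ⟨⟨?_, ?_, ?_, ?_, ?_, ?_, ?_⟩, ?_, ?_, ?_, ?_⟩ <;>
                simp [h4, h5, e1, e2, e3, hP, h1.n, h1.nodes, h1.adj, h1.size, h1.node,
                  h2, h3]
          · simp only [time_when, time_incr, Test.cost, Expr.cost]
            split_ifs <;> omega)
      have hev : (Expr.cell .size (.lit 0) (.reg .i)).eval ((s'.setReg .i i).setReg .hits 0) =
          s.cell .size 0 i := by simp [hsame.size]
      rw [hev] at hin
      obtain ⟨⟨h1, h2, h3, h4, h5⟩, htime⟩ := hin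
      simp only [Finset.sum_const, Finset.card_range, smul_eq_mul, Expr.cost] at htime
      simp only [body, out_block_cons, time_block_cons, Prog.out_set, Prog.time_set, Expr.eval,
        out_block_nil, time_block_nil]
      generalize (Prog.loop Reg.j _ _).out _ = s'' at *
      generalize (Prog.loop Reg.j _ _).time _ = tm at *
      have h5' : s''.reg .hits = hitCount s i := h5
      constructor
      · rw [card_filter_range_succ]
        by_cases hP : hitCount s i = 2
        · refine ⟨⟨?_, ?_, ?_, ?_, ?_, ?_, ?_⟩, ?_, ?_⟩ <;>
            simp [h5', hP, h1.n, h1.u, h1.v, h1.nodes, h1.adj, h1.size, h1.node, h2, h3, hcount]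
        · refine ⟨⟨?_, ?_, ?_, ?_, ?_, ?_, ?_⟩, ?_, ?_⟩ <;>
            simp [h5', hP, h1.n, h1.u, h1.v, h1.nodes, h1.adj, h1.size, h1.node, h2, h3, hcount]
      · simp only [time_when, time_incr, Test.cost, Expr.cost]
        split_ifs <;> omega)
  have hev : (Expr.reg .nodes).eval s₀ = s.reg .nodes := rfl
  rw [hev] at hloop
  obtain ⟨⟨h1, h2, h3⟩, htime⟩ := hloop
  refine ⟨h1, h2, h3, ?_⟩
  have : countNodes.time s = 2 + ((Prog.loop .i (.reg .nodes) body).time s₀ + 0) := rfl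
  rw [this]
  have hsum : ∑ i ∈ Finset.range (s.reg .nodes), (16 * s.cell .size 0 i + 19 + 1) =
    ∑ i ∈ Finset.range (s.reg .nodes), (16 * s.cell .size 0 i + 20) := rfl
  simp only [Expr.cost] at htime
  omega

/-- Appending a new element to a list without repetitions which enumerates `S`. -/
lemma bijOn_append {α : Type*} {f g : ℕ → α} {m : ℕ} {S : Set α} {x : α}
    (h : Set.BijOn f (Set.Iio m) S) (hx : x ∉ S) (hg : ∀ p < m, g p = f p) (hgm : g m = x) :
    Set.BijOn g (Set.Iio (m + 1)) (insert x S) := by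
  have h1 : Set.BijOn g (Set.Iio m) S := h.congr fun p hp => (hg p hp).symm
  have h2 : Set.Iio (m + 1) = insert m (Set.Iio m) := by
    ext p; simp
  rw [h2, ← hgm]
  exact h1.insert (hgm ▸ hx)

/-- The numbers listed by `collectAux`. -/
def auxSet (s : State) : Set ℕ :=
  {w | w < s.reg .n ∧ ((w = s.reg .u ∨ w = s.reg .v) ∨
    (s.cell .adj (s.reg .u) w = 1 ∨ s.cell .adj (s.reg .v) w = 1))}

lemma collectAux_spec (s : State) :
    SameInput s (collectAux.out s) ∧
      Set.BijOn ((collectAux.out s).cell .aux 0) (Set.Iio ((collectAux.out s).reg .numAux))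
        (auxSet s) ∧
      collectAux.time s ≤ 40 * s.reg .n + 4 := by
  let s₀ := s.setReg .numAux 0
  let body : Prog := when (.or (.or (sameTest .x .u) (sameTest .x .v))
      (.or (adjTest .u .x) (adjTest .v .x)))
      (block [.store .aux (.lit 0) (.reg .numAux) (.reg .x), incr .numAux])
  have hloop := Prog.loop_spec (s := s₀) (r := .x) (e := .reg .n) (c := body)
    (fun k s' => SameInput s s' ∧ Set.BijOn (s'.cell .aux 0) (Set.Iio (s'.reg .numAux))
      {w | w < k ∧ ((w = s.reg .u ∨ w = s.reg .v) ∨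
        (s.cell .adj (s.reg .u) w = 1 ∨ s.cell .adj (s.reg .v) w = 1))})
    (fun _ => 39)
    ⟨⟨rfl, rfl, rfl, rfl, fun _ _ => rfl, fun _ _ => rfl, fun _ _ => rfl⟩, by
      simp [s₀, Set.bijOn_empty_iff_left]⟩
    (by
      rintro x - s' ⟨h1, h2⟩
      constructor
      · by_cases hP : (x = s.reg .u ∨ x = s.reg .v) ∨
          (s.cell .adj (s.reg .u) x = 1 ∨ s.cell .adj (s.reg .v) x = 1)
        · constructor
          · constructor <;>
              simp [body, hP, h1.n, h1.u, h1.v, h1.nodes, h1.adj, h1.size, h1.node]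
          · have := bijOn_append (x := x)
              (g := (body.out (s'.setReg .x x)).cell .aux 0) h2 (by simp)
              (by intro p hp; simp [body, hP, h1.u, h1.v, h1.adj, hp.ne])
              (by simp [body, hP, h1.u, h1.v, h1.adj])
            convert this using 1
            · simp [body, hP, h1.u, h1.v, h1.adj]
            · ext w
              simp only [Set.mem_ofPred_eq, Set.mem_insert_iff]
              grind
        · constructor
          · constructor <;>
              simp [body, hP, h1.n, h1.u, h1.v, h1.nodes, h1.adj, h1.size, h1.node]
          · convert h2 using 1
            · simp [body, hP, h1.u, h1.v, h1.adj]
            · simp [body, hP, h1.u, h1.v, h1.adj]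
            · ext w
              simp only [Set.mem_ofPred_eq]
              grind
      · simp only [body, time_when, time_incr, Test.cost, time_block_cons, Prog.time_store,
          time_block_nil, cost_sameTest, cost_adjTest, Expr.cost]
        split_ifs <;> omega)
  have hev : (Expr.reg .n).eval s₀ = s.reg .n := rfl
  rw [hev] at hloop
  obtain ⟨⟨h1, h2⟩, htime⟩ := hloop
  refine ⟨h1, h2, ?_⟩
  have : collectAux.time s = 2 + ((Prog.loop .x (.reg .n) body).time s₀ + 0) := rfl
  rw [this]
  simp only [Finset.sum_const, Finset.card_range, smul_eq_mul, Expr.cost] at htime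
  omega

/-- The pairs `(x, y)` for which `u, x, y, v` is a path, as read from the adjacency matrix. -/
def IsPathPair (s : State) (z : ℕ × ℕ) : Prop :=
  (s.cell .adj (s.reg .u) z.1 = 1 ∧ z.1 ≠ s.reg .v) ∧
    (s.cell .adj z.1 z.2 = 1 ∧ s.cell .adj z.2 (s.reg .v) = 1) ∧ z.2 ≠ s.reg .u

/-- The path list enumerates the pairs without repetition because the vertex list does so; its length
is therefore the number of pairs. -/
lemma collectPaths_spec (s : State)
    (hinj : Set.InjOn (s.cell .aux 0) (Set.Iio (s.reg .numAux))) :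
    SameInput s (collectPaths.out s) ∧
      Set.BijOn (fun p => ((collectPaths.out s).cell .pathX 0 p,
          (collectPaths.out s).cell .pathY 0 p)) (Set.Iio ((collectPaths.out s).reg .numPaths))
        {z | IsPathPair s z ∧ (∃ p < s.reg .numAux, s.cell .aux 0 p = z.1) ∧
          ∃ q < s.reg .numAux, s.cell .aux 0 q = z.2} ∧
      collectPaths.time s ≤ 4 + s.reg .numAux * (40 + s.reg .numAux * 40) := by
  set N := s.reg .numAux with hN
  set a := s.cell .aux 0 with ha
  let s₀ := s.setReg .numPaths 0
  let inner : Prog := block [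
        .set .y (.cell .aux (.lit 0) (.reg .j)),
        when (.and (.and (adjTest .x .y) (adjTest .y .v)) (.not (sameTest .y .u)))
          (block [
            .store .pathX (.lit 0) (.reg .numPaths) (.reg .x),
            .store .pathY (.lit 0) (.reg .numPaths) (.reg .y),
            incr .numPaths])]
  let body : Prog := block [
    .set .x (.cell .aux (.lit 0) (.reg .i)),
    when (.and (adjTest .u .x) (.not (sameTest .x .v))) (.loop .j (.reg .numAux) inner)]
  -- `S i` is listed before iteration `i` of the outer loop, `S' i j` before iteration `j` of the
  -- inner one.
  let S : ℕ → Set (ℕ × ℕ) := fun i =>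
    {z | IsPathPair s z ∧ (∃ p < i, a p = z.1) ∧ ∃ q < N, a q = z.2}
  let S' : ℕ → ℕ → Set (ℕ × ℕ) := fun i j =>
    S i ∪ {z | IsPathPair s z ∧ a i = z.1 ∧ ∃ q < j, a q = z.2}
  let lst : State → ℕ → ℕ × ℕ := fun s' p => (s'.cell .pathX 0 p, s'.cell .pathY 0 p)
  have hloop := Prog.loop_spec (s := s₀) (r := .i) (e := .reg .numAux) (c := body)
    (fun i s' => SameInput s s' ∧ s'.reg .numAux = N ∧ (∀ p, s'.cell .aux 0 p = a p) ∧
      Set.BijOn (lst s') (Set.Iio (s'.reg .numPaths)) (S i))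
    (fun _ => 39 + N * 40)
    ⟨⟨rfl, rfl, rfl, rfl, fun _ _ => rfl, fun _ _ => rfl, fun _ _ => rfl⟩, rfl, fun _ => rfl, by
      simp [s₀, S, Set.bijOn_empty_iff_left]⟩
    (by
      rintro i hi s' ⟨h1, hn, haux, hbij⟩
      replace hi : i < N := hi
      set s₁ := (s'.setReg .i i).setReg .x (a i) with hs₁
      have hout : body.out (s'.setReg .i i) =
          if s.cell .adj (s.reg .u) (a i) = 1 ∧ a i ≠ s.reg .v then
            (Prog.loop .j (.reg .numAux) inner).out s₁ else s₁ := by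
        simp [body, haux, hs₁, h1.u, h1.v, h1.adj]
      have htm : body.time (s'.setReg .i i) =
          15 + if s.cell .adj (s.reg .u) (a i) = 1 ∧ a i ≠ s.reg .v then
            (Prog.loop .j (.reg .numAux) inner).time s₁ else 0 := by
        simp [body, haux, hs₁, h1.u, h1.v, h1.adj]
        omega
      have hsame₁ : SameInput s s₁ :=
        ⟨h1.n, h1.u, h1.v, h1.nodes, h1.adj, h1.size, h1.node⟩
      rw [hout, htm]
      by_cases hP : s.cell .adj (s.reg .u) (a i) = 1 ∧ a i ≠ s.reg .v
      · rw [if_pos hP, if_pos hP]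
        have hin := Prog.loop_spec (s := s₁) (r := .j) (e := .reg .numAux) (c := inner)
          (fun j s'' => SameInput s s'' ∧ s''.reg .numAux = N ∧
            (∀ p, s''.cell .aux 0 p = a p) ∧ s''.reg .x = a i ∧
            Set.BijOn (lst s'') (Set.Iio (s''.reg .numPaths)) (S' i j))
          (fun _ => 39)
          ⟨hsame₁, hn, haux, rfl, by
            rw [show S' i 0 = S i by simp [S']]; exact hbij⟩
          (by
            rintro j hj s'' ⟨g1, gn, gaux, gx, gbij⟩
            replace hj : j < N := by
              have : (Expr.reg .numAux).eval s₁ = N := hn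
              omega
            constructor
            · by_cases hQ : (s.cell .adj (a i) (a j) = 1 ∧ s.cell .adj (a j) (s.reg .v) = 1) ∧
                a j ≠ s.reg .u
              · have hQ' : ((s.cell .adj (a i) (a j) = 1 ∧ s.cell .adj (a j) (s.reg .v) = 1) ∧
                ¬ a j = s.reg .u) := hQ
                refine ⟨?_, ?_, ?_, ?_, ?_⟩
                · constructor <;> simp [inner, gaux, gx, hQ', g1.n, g1.u, g1.v, g1.nodes, g1.adj,
                    g1.size, g1.node]
                · simp [inner, gaux, gx, hQ', g1.u, g1.v, g1.adj, gn]
                · intro p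
                  simp [inner, gaux, gx, hQ', g1.u, g1.v, g1.adj]
                · simp [inner, gaux, gx, hQ', g1.u, g1.v, g1.adj]
                · -- An earlier path `(a i, a j)` would contradict the injectivity of the vertex list.
                  have hnot : (a i, a j) ∉ S' i j := by
                    rintro (⟨-, ⟨p, hp, hpe⟩, -⟩ | ⟨-, -, q, hq, hqe⟩)
                    · have := hinj (Set.mem_Iio.2 (hp.trans hi)) (Set.mem_Iio.2 hi) hpe
                      omega
                    · have := hinj (Set.mem_Iio.2 (hq.trans hj)) (Set.mem_Iio.2 hj) hqe
                      omega
                  have := bijOn_append (x := (a i, a j))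
                    (g := lst (inner.out (s''.setReg .j j))) gbij hnot
                    (by
                      intro p hp
                      simp [lst, inner, gaux, gx, hQ', g1.u, g1.v, g1.adj, hp.ne])
                    (by simp [lst, inner, gaux, gx, hQ', g1.u, g1.v, g1.adj])
                  convert this using 1
                  · simp [inner, gaux, gx, hQ', g1.u, g1.v, g1.adj]
                  · ext z
                    simp only [S', Set.mem_union, Set.mem_ofPred_eq, Set.mem_insert_iff]
                    constructor
                    · rintro (h | ⟨h, h', q, hq, hqe⟩)
                      · exact Or.inr (Or.inl h)
                      · rcases Nat.lt_succ_iff_lt_or_eq.1 hq with hq | rfl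
                        · exact Or.inr (Or.inr ⟨h, h', q, hq, hqe⟩)
                        · exact Or.inl (Prod.ext h'.symm hqe.symm)
                    · rintro (rfl | h | ⟨h, h', q, hq, hqe⟩)
                      · exact Or.inr ⟨⟨hP, hQ⟩, rfl, j, by omega, rfl⟩
                      · exact Or.inl h
                      · exact Or.inr ⟨h, h', q, by omega, hqe⟩
              · have hQ' : ¬ ((s.cell .adj (a i) (a j) = 1 ∧ s.cell .adj (a j) (s.reg .v) = 1) ∧
                ¬ a j = s.reg .u) := hQ
                refine ⟨?_, ?_, ?_, ?_, ?_⟩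
                · constructor <;> simp [inner, gaux, gx, hQ', g1.n, g1.u, g1.v, g1.nodes, g1.adj,
                    g1.size, g1.node]
                · simp [inner, gaux, gx, hQ', g1.u, g1.v, g1.adj, gn]
                · intro p
                  simp [inner, gaux, gx, hQ', g1.u, g1.v, g1.adj]
                · simp [inner, gaux, gx, hQ', g1.u, g1.v, g1.adj]
                · convert gbij using 1
                  · funext p
                    simp [lst, inner, gaux, gx, hQ', g1.u, g1.v, g1.adj]
                  · simp [inner, gaux, gx, hQ', g1.u, g1.v, g1.adj]
                  · ext z
                    simp only [S', Set.mem_union, Set.mem_ofPred_eq]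
                    refine or_congr Iff.rfl ⟨?_, ?_⟩
                    · rintro ⟨h, h', q, hq, hqe⟩
                      rcases Nat.lt_succ_iff_lt_or_eq.1 hq with hq | rfl
                      · exact ⟨h, h', q, hq, hqe⟩
                      · refine absurd h.2 ?_
                        rw [← h', ← hqe]; exact hQ
                    · rintro ⟨h, h', q, hq, hqe⟩
                      exact ⟨h, h', q, by omega, hqe⟩
            · simp only [inner, time_when, time_incr, Test.cost, time_block_cons,
                Prog.time_store, Prog.time_set, time_block_nil, cost_sameTest, cost_adjTest,
                Expr.cost]
              split_ifs <;> omega)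
        have hev : (Expr.reg .numAux).eval s₁ = N := hn
        rw [hev] at hin
        obtain ⟨⟨g1, gn, gaux, gx, gbij⟩, htime⟩ := hin
        refine ⟨⟨g1, gn, gaux, ?_⟩, ?_⟩
        · convert gbij using 1
          ext z
          simp only [S, S', Set.mem_union, Set.mem_ofPred_eq]
          constructor
          · rintro ⟨h, ⟨p, hp, hpe⟩, hq⟩
            rcases Nat.lt_succ_iff_lt_or_eq.1 hp with hp | rfl
            · exact Or.inl ⟨h, ⟨p, hp, hpe⟩, hq⟩
            · exact Or.inr ⟨h, hpe, hq⟩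
          · rintro (⟨h, ⟨p, hp, hpe⟩, hq⟩ | ⟨h, hpe, hq⟩)
            · exact ⟨h, ⟨p, by omega, hpe⟩, hq⟩
            · exact ⟨h, ⟨i, by omega, hpe⟩, hq⟩
        · simp only [Finset.sum_const, Finset.card_range, smul_eq_mul, Expr.cost] at htime
          omega
      · rw [if_neg hP, if_neg hP]
        refine ⟨⟨hsame₁, hn, haux, ?_⟩, by omega⟩
        suffices e : S (i + 1) = S i by rw [e]; exact hbij
        ext z
        simp only [S, Set.mem_ofPred_eq]
        constructor
        · rintro ⟨h, ⟨p, hp, hpe⟩, hq⟩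
          rcases Nat.lt_succ_iff_lt_or_eq.1 hp with hp | rfl
          · exact ⟨h, ⟨p, hp, hpe⟩, hq⟩
          · refine absurd h.1 ?_
            rw [← hpe]; exact hP
        · rintro ⟨h, ⟨p, hp, hpe⟩, hq⟩
          exact ⟨h, ⟨p, by omega, hpe⟩, hq⟩)
  have hev : (Expr.reg .numAux).eval s₀ = N := rfl
  rw [hev] at hloop
  obtain ⟨⟨h1, -, -, h2⟩, htime⟩ := hloop
  refine ⟨h1, h2, ?_⟩
  have : collectPaths.time s = 2 + ((Prog.loop .i (.reg .numAux) body).time s₀ + 0) := rfl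
  rw [this]
  simp only [Finset.sum_const, Finset.card_range, smul_eq_mul, Expr.cost] at htime
  have e : N * (39 + N * 40 + 1) = N * (40 + N * 40) := by ring
  omega

/-- The test of `checkPairs` for the pairs `z = (x, y)` and `z' = (x', y')`. -/
def IsBadPair (s : State) (z z' : ℕ × ℕ) : Prop :=
  ((z.1 ≠ z'.1 ∧ z.1 ≠ z'.2) ∧ (z.2 ≠ z'.1 ∧ z.2 ≠ z'.2)) ∧
    (s.cell .adj z.1 z'.2 ≠ 1 ∧ s.cell .adj z.2 z'.1 ≠ 1)

lemma checkPairs_spec (s : State) :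
    SameInput s (checkPairs.out s) ∧
      ((∃ i < s.reg .numPaths, ∃ j < s.reg .numPaths,
        IsBadPair s (s.cell .pathX 0 i, s.cell .pathY 0 i)
          (s.cell .pathX 0 j, s.cell .pathY 0 j)) → (checkPairs.out s).reg .answer = 0) ∧
      ((¬ ∃ i < s.reg .numPaths, ∃ j < s.reg .numPaths,
        IsBadPair s (s.cell .pathX 0 i, s.cell .pathY 0 i)
          (s.cell .pathX 0 j, s.cell .pathY 0 j)) → (checkPairs.out s).reg .answer = 1) ∧
      checkPairs.time s ≤ 4 + s.reg .numPaths * (3 + s.reg .numPaths * 80) := by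
  classical
  set N := s.reg .numPaths with hN
  let Bad : ℕ → ℕ → Prop := fun i j => IsBadPair s (s.cell .pathX 0 i, s.cell .pathY 0 i)
          (s.cell .pathX 0 j, s.cell .pathY 0 j)
  let s₀ := s.setReg .answer 1
  let body : Prog := block [
    .set .x (.cell .pathX (.lit 0) (.reg .i)),
    .set .y (.cell .pathY (.lit 0) (.reg .i)),
    .set .x' (.cell .pathX (.lit 0) (.reg .j)),
    .set .y' (.cell .pathY (.lit 0) (.reg .j)),
    when (.and
        (.and (.and (.not (sameTest .x .x')) (.not (sameTest .x .y')))
              (.and (.not (sameTest .y .x')) (.not (sameTest .y .y'))))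
        (.and (.not (adjTest .x .y')) (.not (adjTest .y .x'))))
      (.set .answer (.lit 0))]
  let Inv : Prop → State → Prop := fun P s' => SameInput s s' ∧ s'.reg .numPaths = N ∧
    (∀ p, s'.cell .pathX 0 p = s.cell .pathX 0 p) ∧
    (∀ p, s'.cell .pathY 0 p = s.cell .pathY 0 p) ∧
    (P → s'.reg .answer = 0) ∧ (¬ P → s'.reg .answer = 1)
  have hloop := Prog.loop_spec (s := s₀) (r := .i) (e := .reg .numPaths)
    (c := .loop .j (.reg .numPaths) body)
    (fun k => Inv (∃ i < k, ∃ j < N, Bad i j))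
    (fun _ => 2 + N * 80)
    ⟨⟨rfl, rfl, rfl, rfl, fun _ _ => rfl, fun _ _ => rfl, fun _ _ => rfl⟩, rfl, fun _ => rfl,
      fun _ => rfl, by simp, fun _ => rfl⟩
    (by
      rintro i - s' ⟨h1, hn, hx, hy, hans, hans'⟩
      have hin := Prog.loop_spec (s := s'.setReg .i i) (r := .j) (e := .reg .numPaths) (c := body)
        (fun k s'' => Inv ((∃ i' < i, ∃ j < N, Bad i' j) ∨ ∃ j < k, Bad i j) s'' ∧ s''.reg .i = i)
        (fun _ => 79)
        ⟨⟨⟨h1.n, h1.u, h1.v, h1.nodes, h1.adj, h1.size, h1.node⟩, hn, hx, hy,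
          fun h => hans (by simpa using h),
          fun h => hans' (by simpa using h)⟩, rfl⟩
        (by
          rintro j - s'' ⟨⟨g1, gn, gx, gy, gans, gans'⟩, gi⟩
          constructor
          · by_cases hB : Bad i j
            · have hB' := hB
              simp only [Bad, IsBadPair, ne_eq] at hB'
              have e : ((∃ i' < i, ∃ j < N, Bad i' j) ∨ ∃ j' < j + 1, Bad i j') :=
                Or.inr ⟨j, by omega, hB⟩
              refine ⟨⟨?_, ?_, ?_, ?_, ?_, ?_⟩, ?_⟩
              · constructor <;> simp [body, gx, gy, gi, hB', g1.n, g1.u, g1.v, g1.nodes, g1.adj,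
                  g1.size, g1.node]
              · simp [body, gx, gy, gi, hB', g1.adj, gn]
              · intro p; simp [body, gx, gy, gi, hB', g1.adj]
              · intro p; simp [body, gx, gy, gi, hB', g1.adj]
              · intro _; simp [body, gx, gy, gi, hB', g1.adj]
              · exact fun h => absurd e h
              · simp [body, gx, gy, gi, hB', g1.adj]
            · have hB' := hB
              simp only [Bad, IsBadPair, ne_eq] at hB'
              have e : ((∃ i' < i, ∃ j < N, Bad i' j) ∨ ∃ j' < j + 1, Bad i j') ↔
                  ((∃ i' < i, ∃ j < N, Bad i' j) ∨ ∃ j' < j, Bad i j') := by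
                refine or_congr Iff.rfl ⟨?_, ?_⟩
                · rintro ⟨j', hj', h⟩
                  rcases Nat.lt_succ_iff_lt_or_eq.1 hj' with hj' | rfl
                  · exact ⟨j', hj', h⟩
                  · exact absurd h hB
                · rintro ⟨j', hj', h⟩
                  exact ⟨j', by omega, h⟩
              refine ⟨⟨?_, ?_, ?_, ?_, ?_, ?_⟩, ?_⟩
              · constructor <;> simp [body, gx, gy, gi, hB', g1.n, g1.u, g1.v, g1.nodes, g1.adj,
                  g1.size, g1.node]
              · simp [body, gx, gy, gi, hB', g1.adj, gn]
              · intro p; simp [body, gx, gy, gi, hB', g1.adj]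
              · intro p; simp [body, gx, gy, gi, hB', g1.adj]
              · intro h; rw [← gans (e.1 h)]; simp [body, gx, gy, gi, hB', g1.adj]
              · intro h; rw [← gans' (mt e.2 h)]; simp [body, gx, gy, gi, hB', g1.adj]
              · simp [body, gx, gy, gi, hB', g1.adj]
          · simp only [body, time_when, Test.cost, time_block_cons, Prog.time_set,
              time_block_nil, cost_sameTest, cost_adjTest, Expr.cost]
            split_ifs <;> omega)
      have hev : (Expr.reg .numPaths).eval (s'.setReg .i i) = N := hn
      rw [hev] at hin
      obtain ⟨⟨⟨g1, gn, gx, gy, gans, gans'⟩, -⟩, htime⟩ := hin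
      have e : (∃ i' < i + 1, ∃ j < N, Bad i' j) ↔
          ((∃ i' < i, ∃ j < N, Bad i' j) ∨ ∃ j < N, Bad i j) := by
        constructor
        · rintro ⟨i', hi', h⟩
          rcases Nat.lt_succ_iff_lt_or_eq.1 hi' with hi' | rfl
          · exact Or.inl ⟨i', hi', h⟩
          · exact Or.inr h
        · rintro (⟨i', hi', h⟩ | h)
          · exact ⟨i', by omega, h⟩
          · exact ⟨i, by omega, h⟩
      refine ⟨⟨g1, gn, gx, gy, fun h => gans (e.1 h), fun h => gans' (mt e.2 h)⟩, ?_⟩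
      · simp only [Finset.sum_const, Finset.card_range, smul_eq_mul, Expr.cost] at htime
        omega)
  have hev : (Expr.reg .numPaths).eval s₀ = N := rfl
  rw [hev] at hloop
  obtain ⟨⟨h1, -, -, -, h2, h3⟩, htime⟩ := hloop
  refine ⟨h1, h2, h3, ?_⟩
  have : checkPairs.time s = 2 + ((Prog.loop .i (.reg .numPaths)
    (.loop .j (.reg .numPaths) body)).time s₀ + 0) := rfl
  rw [this]
  simp only [Finset.sum_const, Finset.card_range, smul_eq_mul, Expr.cost] at htime
  have e : N * (2 + N * 80 + 1) = N * (3 + N * 80) := by ring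
  omega

end SCDel

/-! ### Correctness and running time of the algorithms -/

namespace SCDel

section Transfer

variable {s s' : State}

lemma SameInput.hitCount (h : SameInput s s') (i : ℕ) : hitCount s' i = hitCount s i := by
  simp only [SCDel.hitCount, h.size, h.node, h.u, h.v]

lemma SameInput.auxSet (h : SameInput s s') : auxSet s' = auxSet s := by
  simp only [SCDel.auxSet, h.n, h.u, h.v, h.adj]

lemma SameInput.isPathPair (h : SameInput s s') (z : ℕ × ℕ) :
    IsPathPair s' z ↔ IsPathPair s z := by
  simp only [IsPathPair, h.u, h.v, h.adj]

lemma SameInput.isBadPair (h : SameInput s s') (z z' : ℕ × ℕ) :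
    IsBadPair s' z z' ↔ IsBadPair s z z' := by
  simp only [IsBadPair, h.adj]

lemma SameInput.storesGraph {n : ℕ} {G : SimpleGraph (Fin n)} (h : SameInput s s')
    (hG : StoresGraph s G) : StoresGraph s' G := by
  intro p q
  simp only [h.adj]
  exact hG p q

end Transfer

lemma card_le_of_bijOn {α : Type*} {f : ℕ → α} {m : ℕ} {S : Set α} {F : Finset α}
    (h : Set.BijOn f (Set.Iio m) S) (hS : ∀ x ∈ S, x ∈ F) : m ≤ F.card := by
  have := Finset.card_le_card_of_injOn (s := Finset.range m) f
    (fun p hp => hS _ (h.mapsTo (Set.mem_Iio.2 (by simpa using hp))))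
    (fun p hp q hq => h.injOn (by simpa using hp) (by simpa using hq))
  simpa using this

section Query

variable {n k : ℕ} {G : SimpleGraph (Fin n)} {K : Fin k → Finset (Fin n)} {u v : Fin n} {s : State}

lemma StoresGraph.eq_one_iff (h : StoresGraph s G) (p q : Fin n) :
    s.cell .adj p q = 1 ↔ G.Adj p q := by
  constructor
  · intro h1
    by_contra h2
    have := (h p q).2 h2
    omega
  · exact (h p q).1

lemma StoresInput.hitCount_eq_two_iff (h : StoresInput s G K u v) (huv : u ≠ v) (p : Fin k) :
    hitCount s p = 2 ↔ u ∈ K p ∧ v ∈ K p := by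
  have himg : (Finset.range (K p).card).image (s.cell .node p) =
      (K p).image Fin.val := by
    ext w
    simp only [Finset.mem_image, Finset.mem_range]
    constructor
    · rintro ⟨q, hq, rfl⟩
      obtain ⟨w, hw, he⟩ := h.node_mem p q hq
      exact ⟨w, hw, he.symm⟩
    · rintro ⟨w, hw, rfl⟩
      exact h.node_surj p w hw
  -- The list of node `p` has no repetitions, because it is as long as the set it enumerates.
  have hinj : Set.InjOn (s.cell .node p) (Finset.range (K p).card : Set ℕ) := by
    apply Finset.injOn_of_card_image_eq
    rw [himg, Finset.card_image_of_injective _ Fin.val_injective, Finset.card_range]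
  have hcount : hitCount s p = ((K p).filter fun w => w = u ∨ w = v).card := by
    unfold hitCount
    rw [h.size, h.left, h.right, ← Finset.card_image_of_injOn
      (hinj.mono (Finset.coe_subset.2 (Finset.filter_subset _ _))),
      ← Finset.card_image_of_injective ((K p).filter fun w => w = u ∨ w = v) Fin.val_injective]
    refine congrArg Finset.card ?_
    ext w
    have hw := Finset.ext_iff.1 himg w
    simp only [Finset.mem_image, Finset.mem_range, Finset.mem_filter] at hw ⊢
    constructor
    · rintro ⟨q, ⟨hq, hq'⟩, rfl⟩
      obtain ⟨x, hx, he⟩ := hw.1 ⟨q, hq, rfl⟩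
      refine ⟨x, ⟨hx, ?_⟩, he⟩
      rw [← he] at hq'
      exact hq'.imp Fin.ext Fin.ext
    · rintro ⟨x, ⟨hx, hx'⟩, rfl⟩
      obtain ⟨q, hq, he⟩ := hw.2 ⟨x, hx, rfl⟩
      refine ⟨q, ⟨hq, ?_⟩, he⟩
      rw [he]
      exact hx'.imp (congrArg _) (congrArg _)
  have hsub : ((K p).filter fun w => w = u ∨ w = v) ⊆ {u, v} := by
    intro w hw
    simpa using (Finset.mem_filter.1 hw).2
  rw [hcount, ← Finset.card_pair huv]
  constructor
  · intro hc
    have := Finset.eq_of_subset_of_card_le hsub hc.ge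
    have hu : u ∈ ({u, v} : Finset (Fin n)) := by simp
    have hv : v ∈ ({u, v} : Finset (Fin n)) := by simp
    rw [← this] at hu hv
    exact ⟨(Finset.mem_filter.1 hu).1, (Finset.mem_filter.1 hv).1⟩
  · rintro ⟨hu, hv⟩
    congr 1
    refine hsub.antisymm fun w hw => ?_
    rw [Finset.mem_insert, Finset.mem_singleton] at hw
    rcases hw with rfl | rfl <;> simp [hu, hv]

lemma StoresInput.card_eq_one_iff (h : StoresInput s G K u v) (huv : u ≠ v) :
    ((Finset.range (s.reg .nodes)).filter fun i => hitCount s i = 2).card = 1 ↔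
      ∃! i, u ∈ K i ∧ v ∈ K i := by
  rw [Finset.card_eq_one, h.numNodes]
  constructor
  · rintro ⟨a, ha⟩
    have ha' : ∀ i : Fin k, (u ∈ K i ∧ v ∈ K i) ↔ (i : ℕ) = a := by
      intro i
      rw [← h.hitCount_eq_two_iff huv, ← @Finset.mem_singleton ℕ a i, ← ha]
      simp
    have hak : a < k := by
      have : a ∈ ({a} : Finset ℕ) := by simp
      rw [← ha] at this
      simpa using (Finset.mem_filter.1 this).1
    exact ⟨⟨a, hak⟩, (ha' _).2 rfl, fun j hj => Fin.ext ((ha' j).1 hj)⟩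
  · rintro ⟨i, hi, huniq⟩
    refine ⟨i, ?_⟩
    ext j
    simp only [Finset.mem_filter, Finset.mem_range, Finset.mem_singleton]
    constructor
    · rintro ⟨hj, hj'⟩
      rw [h.hitCount_eq_two_iff huv ⟨j, hj⟩] at hj'
      exact congrArg Fin.val (huniq _ hj')
    · rintro rfl
      exact ⟨i.isLt, (h.hitCount_eq_two_iff huv i).2 hi⟩

/-- The pairs listed by `collectPaths`. -/
def pathSet (s : State) : Set (ℕ × ℕ) :=
  {z | IsPathPair s z ∧ z.1 ∈ auxSet s ∧ z.2 ∈ auxSet s}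

lemma StoresInput.mem_auxSet_iff (h : StoresInput s G K u v) {w : ℕ} :
    w ∈ auxSet s ↔ ∃ x : Fin n, (x : ℕ) = w ∧ x ∈ auxNodes G u v := by
  simp only [auxSet, Set.mem_ofPred_eq, mem_auxNodes, h.numVertices, h.left, h.right]
  constructor
  · rintro ⟨hw, h1⟩
    refine ⟨⟨w, hw⟩, rfl, ?_⟩
    rw [← h.graph.eq_one_iff, ← h.graph.eq_one_iff, Fin.ext_iff, Fin.ext_iff]
    tauto
  · rintro ⟨x, rfl, h1⟩
    rw [← h.graph.eq_one_iff, ← h.graph.eq_one_iff, Fin.ext_iff, Fin.ext_iff] at h1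
    exact ⟨x.isLt, by tauto⟩

lemma StoresInput.mem_pathSet_iff (h : StoresInput s G K u v) {z : ℕ × ℕ} :
    z ∈ pathSet s ↔ ∃ x y : Fin n, ((x : ℕ), (y : ℕ)) = z ∧
      G.Adj u x ∧ G.Adj x y ∧ G.Adj y v ∧ x ≠ v ∧ y ≠ u := by
  simp only [pathSet, Set.mem_ofPred_eq, h.mem_auxSet_iff]
  constructor
  · rintro ⟨h1, ⟨x, hx, -⟩, ⟨y, hy, -⟩⟩
    rw [IsPathPair, ← hx, ← hy, h.left, h.right, h.graph.eq_one_iff, h.graph.eq_one_iff,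
      h.graph.eq_one_iff, Ne, Ne, ← Fin.ext_iff, ← Fin.ext_iff] at h1
    exact ⟨x, y, Prod.ext hx hy, by tauto⟩
  · rintro ⟨x, y, rfl, h1⟩
    rw [IsPathPair, h.left, h.right, h.graph.eq_one_iff, h.graph.eq_one_iff,
      h.graph.eq_one_iff, Ne, Ne, ← Fin.ext_iff, ← Fin.ext_iff]
    refine ⟨by tauto, ⟨x, rfl, mem_auxNodes.2 (by tauto)⟩, ⟨y, rfl, mem_auxNodes.2 ?_⟩⟩
    exact Or.inr (Or.inr (Or.inr h1.2.2.1.symm))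

/-- The pairs of paths found by `checkPairs` are the excluded six-cycles through the edge. -/
lemma StoresInput.exists_isBadPair_iff (h : StoresInput s G K u v) :
    (∃ z ∈ pathSet s, ∃ z' ∈ pathSet s, IsBadPair s z z') ↔
      ∃ x y x' y', IsBadHexagon G u v x y x' y' := by
  constructor
  · rintro ⟨z, hz, z', hz', hb⟩
    obtain ⟨x, y, rfl, h1, h2, h3, h4, h5⟩ := h.mem_pathSet_iff.1 hz
    obtain ⟨x', y', rfl, h1', h2', h3', h4', h5'⟩ := h.mem_pathSet_iff.1 hz'
    simp only [IsBadPair, ne_eq, ← Fin.ext_iff, h.graph.eq_one_iff] at hb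
    exact ⟨x, y, x', y', h1, h2, h3, h1', h2', h3', Ne.symm h5, Ne.symm h5', Ne.symm h4,
      Ne.symm h4', hb.1.1.1, hb.1.1.2, hb.1.2.1, hb.1.2.2, hb.2.1, hb.2.2⟩
  · rintro ⟨x, y, x', y', hh⟩
    refine ⟨(x, y), h.mem_pathSet_iff.2 ⟨x, y, rfl, hh.ux, hh.xy, hh.yv, hh.ne₃.symm,
      hh.ne₁.symm⟩, (x', y'), h.mem_pathSet_iff.2 ⟨x', y', rfl, hh.ux', hh.xy', hh.yv',
      hh.ne₄.symm, hh.ne₂.symm⟩, ?_⟩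
    simp only [IsBadPair, ne_eq, ← Fin.ext_iff, h.graph.eq_one_iff]
    exact ⟨⟨⟨hh.ne₅, hh.ne₆⟩, hh.ne₇, hh.ne₈⟩, hh.nadj, hh.nadj'⟩

/-- The part of Delete-Query that is executed when `u` and `v` lie in exactly one node. -/
def searchPairs : Prog := block [collectAux, collectPaths, checkPairs]

lemma searchPairs_spec [DecidableRel G.Adj] (h : StoresInput s G K u v) {s₁ : State}
    (h₁ : SameInput s s₁) (huv : G.Adj u v) :
    SameInput s (searchPairs.out s₁) ∧
      ((∃ x y x' y', IsBadHexagon G u v x y x' y') → (searchPairs.out s₁).reg .answer = 0) ∧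
      ((¬ ∃ x y x' y', IsBadHexagon G u v x y x' y') → (searchPairs.out s₁).reg .answer = 1) ∧
      searchPairs.time s₁ ≤ 12 + 40 * n + 323 * (G.degree u ^ 2 * G.degree v ^ 2) := by
  obtain ⟨a1, a2, a3⟩ := collectAux_spec s₁
  have h₂ := h₁.trans a1
  rw [h₁.auxSet] at a2
  rw [h₁.n, h.numVertices] at a3
  set s₂ := collectAux.out s₁ with hs₂
  obtain ⟨b1, b2, b3⟩ := collectPaths_spec s₂ a2.injOn
  have h₃ := h₂.trans b1
  have hset : {z | IsPathPair s₂ z ∧ (∃ p < s₂.reg .numAux, s₂.cell .aux 0 p = z.1) ∧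
      ∃ q < s₂.reg .numAux, s₂.cell .aux 0 q = z.2} = pathSet s := by
    ext z
    simp only [pathSet, Set.mem_ofPred_eq, h₂.isPathPair, ← a2.image_eq, Set.mem_image,
      Set.mem_Iio]
  rw [hset] at b2
  set s₃ := collectPaths.out s₂ with hs₃
  obtain ⟨c1, c2, c3, c4⟩ := checkPairs_spec s₃
  have hbad : (∃ i < s₃.reg .numPaths, ∃ j < s₃.reg .numPaths,
        IsBadPair s₃ (s₃.cell .pathX 0 i, s₃.cell .pathY 0 i)
          (s₃.cell .pathX 0 j, s₃.cell .pathY 0 j)) ↔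
      ∃ x y x' y', IsBadHexagon G u v x y x' y' := by
    rw [← h.exists_isBadPair_iff, ← b2.image_eq]
    simp only [Set.exists_mem_image, Set.mem_Iio, h₃.isBadPair]
  rw [hbad] at c2 c3
  refine ⟨h₃.trans c1, c2, c3, ?_⟩
  have htime : searchPairs.time s₁ =
      collectAux.time s₁ + (collectPaths.time s₂ + (checkPairs.time s₃ + 0)) := rfl
  have hN : s₂.reg .numAux ≤ G.degree u + G.degree v := by
    refine (card_le_of_bijOn a2 (F := (G.neighborFinset u ∪ G.neighborFinset v).image
      Fin.val) ?_).trans ?_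
    · intro w hw
      obtain ⟨x, rfl, hx⟩ := h.mem_auxSet_iff.1 hw
      refine Finset.mem_image_of_mem _ ?_
      rw [mem_auxNodes] at hx
      simp only [Finset.mem_union, SimpleGraph.mem_neighborFinset]
      rcases hx with rfl | rfl | hx | hx
      · exact Or.inr huv.symm
      · exact Or.inl huv
      · exact Or.inl hx
      · exact Or.inr hx
    · refine Finset.card_image_le.trans ((Finset.card_union_le _ _).trans ?_)
      rw [SimpleGraph.card_neighborFinset_eq_degree, SimpleGraph.card_neighborFinset_eq_degree]
  have hP : s₃.reg .numPaths ≤ G.degree u * G.degree v := by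
    refine (card_le_of_bijOn b2 (F := (G.neighborFinset u ×ˢ G.neighborFinset v).image
      (fun z => ((z.1 : ℕ), (z.2 : ℕ)))) ?_).trans ?_
    · intro z hz
      obtain ⟨x, y, rfl, h1, -, h2, -⟩ := h.mem_pathSet_iff.1 hz
      exact Finset.mem_image.2 ⟨(x, y), by simp [h1, h2.symm], rfl⟩
    · refine Finset.card_image_le.trans ?_
      rw [Finset.card_product, SimpleGraph.card_neighborFinset_eq_degree,
        SimpleGraph.card_neighborFinset_eq_degree]
  have hdu : 1 ≤ G.degree u := (G.degree_pos_iff_exists_adj u).2 ⟨v, huv⟩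
  have hdv : 1 ≤ G.degree v := (G.degree_pos_iff_exists_adj v).2 ⟨u, huv.symm⟩
  rw [htime]
  generalize G.degree u = d at *
  generalize G.degree v = e at *
  generalize s₂.reg .numAux = N at *
  generalize s₃.reg .numPaths = P at *
  -- With `D = d * e`, the lists have length `N ≤ 2 * D` and `P ≤ D`, so that the quadratic double
  -- loops over them take `O(D ^ 2)` steps.
  have e1 : 1 ≤ d * e := Nat.mul_pos hdu hdv
  have e2 : d + e ≤ 2 * (d * e) := by nlinarith
  have e3 : d ^ 2 * e ^ 2 = (d * e) * (d * e) := by ring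
  have e4 : N ≤ 2 * (d * e) := hN.trans e2
  have e5 : N * N ≤ (2 * (d * e)) * (2 * (d * e)) := Nat.mul_le_mul e4 e4
  have e6 : P * P ≤ (d * e) * (d * e) := Nat.mul_le_mul hP hP
  have e7 : d * e ≤ (d * e) * (d * e) := Nat.le_mul_of_pos_left _ e1
  rw [e3]
  generalize d * e = D at *
  nlinarith

/-- The bound on the time of `countNodes`: nodes are nonempty, so that their number is at most their
total size. -/
lemma StoresInput.sum_size_le [DecidableRel G.Adj] {T : SimpleGraph (Fin k)}
    (h : StoresInput s G K u v) (hG : StronglyChordal G) (hT : IsCliqueTree G K T) :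
    ∑ i ∈ Finset.range (s.reg .nodes), (16 * s.cell .size 0 i + 20) ≤
      72 * (n + G.edgeFinset.card) := by
  have : Nonempty (Fin n) := ⟨u⟩
  have hsum := hG.sum_card_maxClique_le hT.injective fun i => (hT.range_eq _).1 ⟨i, rfl⟩
  rw [Fintype.card_fin] at hsum
  rw [h.numNodes, Finset.sum_range]
  have hpos : ∀ i, 1 ≤ (K i).card := by
    intro i
    have hK := (hT.range_eq _).1 ⟨i, rfl⟩
    by_contra hc
    have he : K i = ∅ := by rw [← Finset.card_eq_zero]; omega
    have := hK.2 (y := {u}) (by simp) (by simp [he])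
    simp [he] at this
  calc ∑ i : Fin k, (16 * s.cell .size 0 i + 20) ≤ ∑ i, 36 * (K i).card := by
        refine Finset.sum_le_sum fun i _ => ?_
        rw [h.size]
        have := hpos i
        omega
    _ = 36 * ∑ i, (K i).card := by rw [Finset.mul_sum]
    _ ≤ _ := by omega

lemma deleteQuery_out (s : State) : deleteQuery.out s =
    if s.cell .adj (s.reg .u) (s.reg .v) = 1 then
      if (countNodes.out (s.setReg .answer 0)).reg .count = 1 then
        searchPairs.out (countNodes.out (s.setReg .answer 0))
      else countNodes.out (s.setReg .answer 0)
    else s.setReg .answer 0 := by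
  by_cases h1 : s.cell .adj (s.reg .u) (s.reg .v) = 1 <;>
  by_cases h2 : (countNodes.out (s.setReg .answer 0)).reg .count = 1 <;>
  simp [deleteQuery, searchPairs, h1, h2]

lemma deleteQuery_time (s : State) : deleteQuery.time s =
    8 + if s.cell .adj (s.reg .u) (s.reg .v) = 1 then
      countNodes.time (s.setReg .answer 0) + 4 +
      if (countNodes.out (s.setReg .answer 0)).reg .count = 1 then
        searchPairs.time (countNodes.out (s.setReg .answer 0))
      else 0
    else 0 := by
  by_cases h1 : s.cell .adj (s.reg .u) (s.reg .v) = 1 <;>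
  by_cases h2 : (countNodes.out (s.setReg .answer 0)).reg .count = 1 <;>
  simp [deleteQuery, searchPairs, h1, h2] <;> omega

/-- Delete-Query leaves its input as it was, and answers `1` or `0` according to whether `{u, v}` is
an edge that can be deleted. -/
lemma deleteQuery_spec [DecidableRel G.Adj] {T : SimpleGraph (Fin k)}
    (hG : StronglyChordal G) (hT : IsCliqueTree G K T) (h : StoresInput s G K u v) :
    SameInput s (deleteQuery.out s) ∧
      ((G.Adj u v ∧ StronglyChordal (deleteEdge G u v)) →
        (deleteQuery.out s).reg .answer = 1) ∧
      (¬ (G.Adj u v ∧ StronglyChordal (deleteEdge G u v)) →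
        (deleteQuery.out s).reg .answer = 0) := by
  have hs₀ : SameInput s (s.setReg .answer 0) :=
    ⟨rfl, rfl, rfl, rfl, fun _ _ => rfl, fun _ _ => rfl, fun _ _ => rfl⟩
  rw [deleteQuery_out]
  have hadj : s.cell .adj (s.reg .u) (s.reg .v) = 1 ↔ G.Adj u v := by
    rw [h.left, h.right, h.graph.eq_one_iff]
  by_cases huv : G.Adj u v
  swap
  · rw [if_neg (hadj.not.2 huv)]
    exact ⟨hs₀, fun h' => absurd h'.1 huv, fun _ => rfl⟩
  rw [if_pos (hadj.2 huv), stronglyChordal_deleteEdge_iff hG huv,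
    ← existsUnique_isMaxClique_iff huv, hT.existsUnique_iff]
  obtain ⟨a1, a2, a3, -⟩ := countNodes_spec (s.setReg .answer 0)
  have h₁ := hs₀.trans a1
  simp only [hs₀.hitCount, hs₀.nodes] at a3
  have hcount : (countNodes.out (s.setReg .answer 0)).reg .count = 1 ↔
      ∃! i, u ∈ K i ∧ v ∈ K i := by
    rw [a3, h.card_eq_one_iff huv.ne]
  by_cases hone : ∃! i, u ∈ K i ∧ v ∈ K i
  · rw [if_pos (hcount.2 hone)]
    obtain ⟨b1, b2, b3, -⟩ := searchPairs_spec h h₁ huv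
    refine ⟨b1, fun h' => b3 ?_, fun h' => b2 ?_⟩
    · rintro ⟨x, y, x', y', hh⟩
      exact h'.2.2 x y x' y' hh
    · by_contra hn
      push Not at hn
      exact h' ⟨huv, hone, hn⟩
  · rw [if_neg (hcount.not.2 hone)]
    exact ⟨h₁, fun h' => absurd h'.2.1 hone, fun _ => a2⟩

lemma deleteQuery_time_le [DecidableRel G.Adj] {T : SimpleGraph (Fin k)}
    (hG : StronglyChordal G) (hT : IsCliqueTree G K T) (h : StoresInput s G K u v)
    (huv : G.Adj u v) : deleteQuery.time s ≤
      500 * (G.degree u ^ 2 * G.degree v ^ 2 * (n + G.edgeFinset.card)) := by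
  have hs₀ : SameInput s (s.setReg .answer 0) :=
    ⟨rfl, rfl, rfl, rfl, fun _ _ => rfl, fun _ _ => rfl, fun _ _ => rfl⟩
  obtain ⟨a1, -, -, a4⟩ := countNodes_spec (s.setReg .answer 0)
  obtain ⟨-, -, -, b4⟩ := searchPairs_spec h (hs₀.trans a1) huv
  have hsize := h.sum_size_le hG hT
  have a4' : countNodes.time (s.setReg .answer 0) ≤ 4 + 72 * (n + G.edgeFinset.card) :=
    a4.trans (Nat.add_le_add_left hsize 4)
  have hdu : 1 ≤ G.degree u := (G.degree_pos_iff_exists_adj u).2 ⟨v, huv⟩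
  have hdv : 1 ≤ G.degree v := (G.degree_pos_iff_exists_adj v).2 ⟨u, huv.symm⟩
  have hn : 1 ≤ n := by have := u.isLt; omega
  have hD : 1 ≤ G.degree u ^ 2 * G.degree v ^ 2 :=
    Nat.mul_pos (Nat.pow_pos hdu) (Nat.pow_pos hdv)
  have ht : deleteQuery.time s ≤ 8 + (countNodes.time (s.setReg .answer 0) + 4 +
      searchPairs.time (countNodes.out (s.setReg .answer 0))) := by
    rw [deleteQuery_time]
    split_ifs <;> omega
  have hM : n + G.edgeFinset.card ≤
      G.degree u ^ 2 * G.degree v ^ 2 * (n + G.edgeFinset.card) :=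
    Nat.le_mul_of_pos_left _ hD
  have hX : G.degree u ^ 2 * G.degree v ^ 2 ≤
      G.degree u ^ 2 * G.degree v ^ 2 * (n + G.edgeFinset.card) :=
    Nat.le_mul_of_pos_right _ (by omega)
  omega

lemma deleteQuery_time_of_not_adj (h : StoresInput s G K u v) (huv : ¬ G.Adj u v) :
    deleteQuery.time s = 8 := by
  rw [deleteQuery_time, if_neg]
  rwa [h.left, h.right, h.graph.eq_one_iff]

lemma delete_time_le (s : State) : delete.time s ≤ deleteQuery.time s + 12 := by
  simp [delete]
  split_ifs <;> omega

lemma delete_out (s : State) : delete.out s =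
    if (deleteQuery.out s).reg .answer = 1 then
      (((deleteQuery.out s).setCell .adj ((deleteQuery.out s).reg .u)
        ((deleteQuery.out s).reg .v) 0).setCell .adj ((deleteQuery.out s).reg .v)
        ((deleteQuery.out s).reg .u) 0)
    else deleteQuery.out s := by
  by_cases h1 : (deleteQuery.out s).reg .answer = 1 <;> simp [delete, h1]

lemma delete_spec [DecidableRel G.Adj] {T : SimpleGraph (Fin k)}
    (hG : StronglyChordal G) (hT : IsCliqueTree G K T) (h : StoresInput s G K u v) :
    ∃ G' : SimpleGraph (Fin n), StoresGraph (delete.out s) G' ∧ StronglyChordal G' ∧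
      (StronglyChordal (deleteEdge G u v) → G' = deleteEdge G u v) ∧
      (¬ StronglyChordal (deleteEdge G u v) → G' = G) := by
  obtain ⟨h1, h2, h3⟩ := deleteQuery_spec hG hT h
  rw [delete_out]
  by_cases hdel : G.Adj u v ∧ StronglyChordal (deleteEdge G u v)
  · rw [if_pos (h2 hdel)]
    refine ⟨deleteEdge G u v, ?_, hdel.2, fun _ => rfl, fun h' => absurd hdel.2 h'⟩
    intro p q
    have hpq := h1.storesGraph h.graph p q
    rw [h1.u, h1.v, h.left, h.right, deleteEdge_adj]
    simp only [State.setCell_cell, true_and, ← Fin.ext_iff]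
    by_cases e1 : p = u ∧ q = v
    · simp [e1]
    · by_cases e2 : p = v ∧ q = u
      · simp [e2]
      · rw [if_neg e2, if_neg e1]
        exact ⟨fun h' => hpq.1 h'.1, fun h' => hpq.2 fun h'' => h' ⟨h'', e1, e2⟩⟩
  · rw [if_neg (by rw [h3 hdel]; omega)]
    refine ⟨G, h1.storesGraph h.graph, hG, fun h' => ?_, fun _ => rfl⟩
    have huv : ¬ G.Adj u v := fun huv => hdel ⟨huv, h'⟩
    ext p q
    rw [deleteEdge_adj]
    constructor
    · intro hpq
      refine ⟨hpq, ?_, ?_⟩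
      · rintro ⟨rfl, rfl⟩; exact huv hpq
      · rintro ⟨rfl, rfl⟩; exact huv hpq.symm
    · exact fun hpq => hpq.1

end Query

end SCDel

theorem mainTheorem3 :
    -- When an edge can be deleted, and how this is seen on `P4` paths in `G[N[u] ∪ N[v]]`.
    (∀ (V : Type*) [Fintype V] (G : SimpleGraph V) (u v : V),
      SCDel.StronglyChordal G → G.Adj u v →
        (SCDel.StronglyChordal (SCDel.deleteEdge G u v) ↔
          (∃! K : Finset V, SCDel.IsMaxClique G K ∧ u ∈ K ∧ v ∈ K) ∧
          ¬ ∃ c : Fin 6 → V, SCDel.IsOnlyStrongChord G c u v) ∧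
        (∀ (ι : Type*) (K : ι → Finset V) (T : SimpleGraph ι), SCDel.IsCliqueTree G K T →
          ((∃! S : Finset V, SCDel.IsMaxClique G S ∧ u ∈ S ∧ v ∈ S) ↔
            ∃! i : ι, u ∈ K i ∧ v ∈ K i)) ∧
        ((∃ c : Fin 6 → V, SCDel.IsOnlyStrongChord G c u v) ↔ SCDel.HasBadP4Pair G u v)) ∧
    -- Correctness and running time of Delete-Query and Delete.
    (∃ C : ℕ, ∀ (n k : ℕ) (G : SimpleGraph (Fin n)) [DecidableRel G.Adj]
      (K : Fin k → Finset (Fin n)) (T : SimpleGraph (Fin k)) (u v : Fin n) (s : SCDel.State),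
      SCDel.StronglyChordal G → SCDel.IsCliqueTree G K T → SCDel.StoresInput s G K u v →
        ((SCDel.deleteQuery.out s).reg .answer = 1 ↔
          G.Adj u v ∧ SCDel.StronglyChordal (SCDel.deleteEdge G u v)) ∧
        ((SCDel.deleteQuery.out s).reg .answer = 0 ↔
          ¬ (G.Adj u v ∧ SCDel.StronglyChordal (SCDel.deleteEdge G u v))) ∧
        (G.Adj u v → SCDel.deleteQuery.time s ≤
          C * (G.degree u ^ 2 * G.degree v ^ 2 * (n + G.edgeFinset.card))) ∧
        (¬ G.Adj u v → SCDel.deleteQuery.time s ≤ C) ∧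
        SCDel.delete.time s ≤ SCDel.deleteQuery.time s + C ∧
        ∃ G' : SimpleGraph (Fin n),
          SCDel.StoresGraph (SCDel.delete.out s) G' ∧ SCDel.StronglyChordal G' ∧
          (SCDel.StronglyChordal (SCDel.deleteEdge G u v) → G' = SCDel.deleteEdge G u v) ∧
          (¬ SCDel.StronglyChordal (SCDel.deleteEdge G u v) → G' = G)) := by
  refine ⟨fun V _ G u v hG huv => ⟨SCDel.stronglyChordal_deleteEdge_iff_maxClique hG huv,
    fun ι K T hT => hT.existsUnique_iff, ?_⟩, 500, ?_⟩
  · rw [SCDel.exists_isOnlyStrongChord_iff huv, SCDel.hasBadP4Pair_iff huv]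
  · intro n k G _ K T u v s hG hT hs
    obtain ⟨-, h1, h0⟩ := SCDel.deleteQuery_spec hG hT hs
    refine ⟨⟨fun h => ?_, h1⟩, ⟨fun h => ?_, h0⟩, SCDel.deleteQuery_time_le hG hT hs,
      fun huv => ?_, ?_, SCDel.delete_spec hG hT hs⟩
    · by_contra hn
      have := h0 hn
      omega
    · intro hd
      have := h1 hd
      omega
    · rw [SCDel.deleteQuery_time_of_not_adj hs huv]
      norm_num
    · have := SCDel.delete_time_le s
      omega
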